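/- Let $h\colon[0,1]\to\mathbb R$ be continuous and non-increasing with $h(0)=1$, $h(1)=0$, $\int_0^1 h(\xi)\,d\xi>\tfrac12$ and $h(\zeta)<h(0)$ for all $0<\zeta\le 1$. **The table.** For $\rho>0$ and $0<\alpha<\pi/2$ put $s_\alpha=\rho\alpha/\int_0^1 h(\xi)\,d\xi$, and let $\Gamma$ be the convex $C^2$ curve, symmetric about its midpoint, which consists of a circular arc of radius $\rho$ and angle $\pi-2\alpha$, continued at each of its two ends by a segment of length $s_\alpha$ whose curvature, at arc length distance $s\in[0,s_\alpha]$ from the circular arc, has absolute value $\frac1\rho\,h(s/s_\alpha)$. (So $\Gamma$ is a semicircle of which an arc of angle $\alpha$ at each end has been replaced by a smoothened segment, along which the tangent also turns by the angle $\alpha$.) Two copies of $\Gamma$ joined at their endpoints (separation $L=0$) bound a convex billiard table $Q_\alpha$ with $C^2$ boundary. Its billiard map acts on pairs $(s,\varphi)$, where $s$ is the arc length parameter (modulo the perimeter) of a reflection point and $\varphi\in(-\frac\pi2,\frac\pi2)$ the angle of reflection, measured from the inward normal. A $p$-periodic orbit ($p$ the minimal period) is called linearly stable if the derivative $M$ of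 the $p$-th iterate of the billiard map at a point of the orbit exists and satisfies $\det M=1$ and $|\operatorname{tr}M|<2$. **Condition (C).** There is an integer $n_*\ge 0$ such that $$\frac{2n_*+1}{2n_*+2}<\int_0^1 h(\xi)\,d\xi ,$$ and every $\zeta\in[0,1]$ with $$\frac{2n_*+1}{2n_*+2}\,(1-\zeta)=\int_\zeta^1 h(\xi)\,d\xi \qquad\text{satisfies}\qquad h(\zeta)\neq\frac{2n_*+\frac32}{2n_*+2}.$$ **Theorem.** Suppose that $h$ satisfies (C), and let $n_*$ be as in (C). Then there is $\alpha_0>0$, depending only on $h$ and $n_*$, such that for every $0<\alpha<\alpha_0$ and every $\rho>0$ the table $Q_\alpha$ has a linearly stable periodic orbit of period $4(n_*+1)$. -/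

import Mathlib

noncomputable section

namespace SmoothStadium

/-- Arc length `s_α = ρ α / ∫₀¹ h` of the smoothened segment which replaces a circular arc of
angle `α` of the circle of radius `ρ`; the curvature along it is `h (s / s_α) / ρ`. -/
def smoothLength (ρ α : ℝ) (h : ℝ → ℝ) : ℝ :=
  ρ * α / ∫ ξ in (0 : ℝ)..1, h ξ

/-- Length of the focusing component `Γ`: a circular arc of angle `π - 2 α` together with the
two smoothened segments at its ends. -/
def componentLength (ρ α : ℝ) (h : ℝ → ℝ) : ℝ :=
  2 * smoothLength ρ α h + ρ * (Real.pi - 2 * α)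

/-- Absolute value of the curvature of `Γ` at arc length `s`, for `0 ≤ s ≤ componentLength`.
It is symmetric about the midpoint of `Γ` and equals `h 1 / ρ` at both endpoints. -/
def componentCurvature (ρ α : ℝ) (h : ℝ → ℝ) (s : ℝ) : ℝ :=
  if s < smoothLength ρ α h then
    h (1 - s / smoothLength ρ α h) / ρ
  else if s ≤ componentLength ρ α h - smoothLength ρ α h then
    1 / ρ
  else
    h ((s - (componentLength ρ α h - smoothLength ρ α h)) / smoothLength ρ α h) / ρ

/-- Perimeter of the joined table, whose boundary consists of two copies of `Γ`. -/
def perimeter (ρ α : ℝ) (h : ℝ → ℝ) : ℝ :=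
  2 * componentLength ρ α h

/-- Absolute value of the curvature of the boundary of the joined table, as a function of the
arc length `s : ℝ` (counterclockwise, `s = 0` at one of the two joints): the periodic extension
of the curvature of `Γ`. -/
def curvature (ρ α : ℝ) (h : ℝ → ℝ) (s : ℝ) : ℝ :=
  componentCurvature ρ α h (Int.fract (s / componentLength ρ α h) * componentLength ρ α h)

/-- Angle of the tangent of the boundary. -/
def tangentAngle (ρ α : ℝ) (h : ℝ → ℝ) (s : ℝ) : ℝ :=
  ∫ σ in (0 : ℝ)..s, curvature ρ α h σ

/-- Unit tangent of the boundary. -/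
def tangent (ρ α : ℝ) (h : ℝ → ℝ) (s : ℝ) : ℝ × ℝ :=
  (Real.cos (tangentAngle ρ α h s), Real.sin (tangentAngle ρ α h s))

/-- Inward unit normal of the boundary. -/
def normal (ρ α : ℝ) (h : ℝ → ℝ) (s : ℝ) : ℝ × ℝ :=
  (-Real.sin (tangentAngle ρ α h s), Real.cos (tangentAngle ρ α h s))

/-- Arc length parametrization of the boundary of the joined table, with one of the two joints
at the origin. It is the curve with the above curvature, closed up after one perimeter. -/
def boundary (ρ α : ℝ) (h : ℝ → ℝ) (s : ℝ) : ℝ × ℝ :=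
  (∫ σ in (0 : ℝ)..s, Real.cos (tangentAngle ρ α h σ),
   ∫ σ in (0 : ℝ)..s, Real.sin (tangentAngle ρ α h σ))

/-- One step of the billiard. A state `(s, φ)` is the position `s` of a reflection, together with
the angle `φ`, `|φ| < π / 2`, from the inward normal to the velocity right after this reflection,
counted positively in the direction of the tangent. The particle moves from the boundary point
at `x.1` along a straight line to the boundary point at `y.1`, arrives there with velocity
`sin φ' T - cos φ' N`, and leaves it with the reflected velocity `sin φ' T + cos φ' N`,
`φ' = y.2`. Since the table is convex, such a ray meets the boundary in exactly one further
point. Its parameter is determined modulo the perimeter; the one in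
`(x.1, x.1 + perimeter)` is used. -/
def IsStep (ρ α : ℝ) (h : ℝ → ℝ) (x y : ℝ × ℝ) : Prop :=
  |x.2| < Real.pi / 2 ∧ |y.2| < Real.pi / 2 ∧
  x.1 < y.1 ∧ y.1 < x.1 + perimeter ρ α h ∧
  ∃ τ : ℝ, 0 < τ ∧
    boundary ρ α h y.1 - boundary ρ α h x.1 =
      τ • (Real.sin x.2 • tangent ρ α h x.1 + Real.cos x.2 • normal ρ α h x.1) ∧
    boundary ρ α h y.1 - boundary ρ α h x.1 =
      τ • (Real.sin y.2 • tangent ρ α h y.1 - Real.cos y.2 • normal ρ α h y.1)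

open Classical in
/-- The billiard map `(s, φ) ↦ (s', φ')` of the joined table, lifted to `s ∈ ℝ`
(the value outside the phase space `|φ| < π / 2` is a convention). -/
def billiardMap (ρ α : ℝ) (h : ℝ → ℝ) (x : ℝ × ℝ) : ℝ × ℝ :=
  if hx : ∃ y, IsStep ρ α h x y then hx.choose else x

/-- `x` and `y` are lifts of the same state. -/
def SameState (ρ α : ℝ) (h : ℝ → ℝ) (x y : ℝ × ℝ) : Prop :=
  ∃ m : ℤ, y = (x.1 + m * perimeter ρ α h, x.2)

/-- The state `x` lies on a periodic billiard orbit of (minimal) period `p`. -/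
def IsPeriodicState (ρ α : ℝ) (h : ℝ → ℝ) (p : ℕ) (x : ℝ × ℝ) : Prop :=
  0 < p ∧ |x.2| < Real.pi / 2 ∧
  SameState ρ α h x ((billiardMap ρ α h)^[p] x) ∧
  ∀ q : ℕ, 0 < q → q < p → ¬ SameState ρ α h x ((billiardMap ρ α h)^[q] x)

/-- Linear stability (ellipticity) of the `p`-periodic orbit through `x`: the `p`-th iterate of
the billiard map is differentiable at `x`, and its derivative `M` satisfies `det M = 1` and
`|tr M| < 2`, i.e. `M` has two distinct complex conjugate eigenvalues of modulus one. -/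
def IsLinearlyStable (ρ α : ℝ) (h : ℝ → ℝ) (p : ℕ) (x : ℝ × ℝ) : Prop :=
  ∃ M : ℝ × ℝ →L[ℝ] ℝ × ℝ, HasFDerivAt ((billiardMap ρ α h)^[p]) M x ∧
    LinearMap.det (M : ℝ × ℝ →ₗ[ℝ] ℝ × ℝ) = 1 ∧
    |LinearMap.trace ℝ (ℝ × ℝ) (M : ℝ × ℝ →ₗ[ℝ] ℝ × ℝ)| < 2

/-- The non-degeneracy condition (C) on `h`, for a given integer `n ≥ 0`. -/
def NonDegenerate (h : ℝ → ℝ) (n : ℕ) : Prop :=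
  (2 * (n : ℝ) + 1) / (2 * n + 2) < ∫ ξ in (0 : ℝ)..1, h ξ ∧
  ∀ ζ ∈ Set.Icc (0 : ℝ) 1,
    (2 * (n : ℝ) + 1) / (2 * n + 2) * (1 - ζ) = ∫ ξ in ζ..1, h ξ →
      h ζ ≠ (2 * (n : ℝ) + 3 / 2) / (2 * n + 2)

end SmoothStadium

end

/-! For `α = 0` the table is a disc, and the regular `4(n+1)`-gon with half step `δ₀ = π / (4(n+1))`
is a parabolic orbit. For small `α` one looks for an orbit near it which is symmetric in the axis
through the midpoints of the two arcs: two reflections at mirror points `s = s_α u` and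
`componentLength - s` of the smoothened segments of one component, with a common angle `φ`, and
`2n+1` reflections on each circular arc, with half steps `δ₀ + x` and `δ₀ + y`.

Put `k = 2n+1`. The flight from a segment to an arc must pass the centre of that arc at the distance
`ρ cos (δ₀ + x)` (for the other arc, `y` and `-u` replace `x` and `u`), and the two flights at `s`
must obey the reflection law, `k (y - x) = 2 θ(s)` with `θ` the tangent angle. To first order in `α`
the distance conditions give `x = -α β(u) / (k+1)` and `y = -α β(-u) / (k+1)`, where `β(u) = (u - 1)
/ ∫ h + 1`. The reflection law then becomes `∫_{1-u}^1 h = k/(k+1) · u`, the equation of (C) with `ζ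
= 1 - u`. It has a root `u₀` at which the difference of the two sides changes sign
(`exists_profile_root`), so the intermediate value theorem yields an exact solution nearby for every
small `α` (`exists_symmetric_solution`). Lengths are measured in units of `ρ`, so the smallness of
`α` does not depend on `ρ`.

As `α → 0` the derivatives along the two halves of the orbit tend to the same matrix, of determinant
1 and trace `w = 2 - 8(n+1)(1-κ)`, where `κ = h(1-u₀)`. The full trace thus tends to `w² - 2`, which
lies in `(-2, 2)` exactly when `0 < |w| < 2`. The bound `w > -2` is `κ > k/(k+1)`, which holds at
the root by monotonicity of `h`; `w < 2` is `κ < 1`; and `w ≠ 0` is the non-degeneracy in (C).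
Continuity of the trace (`exists_abs_cycleTrace_lt`) carries this over to small `α`.

The billiard map is differentiated by the implicit function theorem (`IsFlight.hasFDerivAt`). Period
and derivative are then read off from an explicit chain of flights (`IsTable.half_chain`). -/

namespace SmoothStadium

open Real Set Filter Topology MeasureTheory intervalIntegral

/-- The hypotheses on the profile and the parameters under which the table is a closed convex
curve of class `C²`. -/
structure IsTable (ρ α : ℝ) (h : ℝ → ℝ) : Prop where
  cont : ContinuousOn h (Icc 0 1)
  anti : AntitoneOn h (Icc 0 1)
  zero : h 0 = 1
  one : h 1 = 0
  int_pos : 0 < ∫ ξ in (0 : ℝ)..1, h ξ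
  rho_pos : 0 < ρ
  alpha_pos : 0 < α
  alpha_lt : α < π / 2

/-! ### Geometry of the boundary curve: curvature, tangent angle, symmetries. -/

section Curvature

variable {ρ α : ℝ} {h : ℝ → ℝ}

namespace IsTable

theorem smoothLength_pos (H : IsTable ρ α h) : 0 < smoothLength ρ α h :=
  div_pos (mul_pos H.rho_pos H.alpha_pos) H.int_pos

theorem two_smoothLength_lt (H : IsTable ρ α h) :
    2 * smoothLength ρ α h < componentLength ρ α h := by
  have h1 : 0 < ρ * (π - 2 * α) := mul_pos H.rho_pos (by linarith [H.alpha_lt])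
  unfold componentLength
  linarith

theorem componentLength_pos (H : IsTable ρ α h) : 0 < componentLength ρ α h := by
  linarith [H.two_smoothLength_lt, H.smoothLength_pos]

theorem perimeter_pos (H : IsTable ρ α h) : 0 < perimeter ρ α h := by
  unfold perimeter
  linarith [H.componentLength_pos]

/-- `componentCurvature` as a single evaluation of the profile. -/
theorem componentCurvature_eq (H : IsTable ρ α h) (s : ℝ) :
    componentCurvature ρ α h s = h (max 0 (max (1 - s / smoothLength ρ α h)
      (1 - (componentLength ρ α h - s) / smoothLength ρ α h))) / ρ := by
  have hs := H.smoothLength_pos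
  have hl := H.two_smoothLength_lt
  set a := smoothLength ρ α h with ha
  set l := componentLength ρ α h with hl'
  have e : 1 - (l - s) / a = (s - (l - a)) / a := by field_simp; ring
  unfold componentCurvature
  rw [← ha, ← hl']
  split_ifs with h1 h2
  · have h3 : 1 - (l - s) / a ≤ 1 - s / a := by
      have : s / a ≤ (l - s) / a := by gcongr; linarith
      linarith
    have h4 : s / a < 1 := by rw [div_lt_one hs]; exact h1
    rw [max_eq_left h3, max_eq_right (by linarith)]
  · have h3 : 1 - s / a ≤ 0 := by
      have : 1 ≤ s / a := by rw [one_le_div hs]; linarith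
      linarith
    have h4 : 1 - (l - s) / a ≤ 0 := by
      rw [e]; exact div_nonpos_of_nonpos_of_nonneg (by linarith) hs.le
    rw [max_eq_left (max_le h3 h4), H.zero]
  · have h3 : 1 - s / a ≤ 1 - (l - s) / a := by
      have : (l - s) / a ≤ s / a := by gcongr; linarith
      linarith
    have h4 : 0 ≤ (s - (l - a)) / a := div_nonneg (by linarith) hs.le
    rw [max_eq_right h3, e, max_eq_right h4]

theorem componentCurvature_symm (H : IsTable ρ α h) (s : ℝ) :
    componentCurvature ρ α h (componentLength ρ α h - s) = componentCurvature ρ α h s := by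
  rw [H.componentCurvature_eq, H.componentCurvature_eq, sub_sub_cancel, max_comm (1 - _) (1 - _)]

theorem profile_arg_mem (H : IsTable ρ α h) {s : ℝ} (hs : s ∈ Icc 0 (componentLength ρ α h)) :
    max 0 (max (1 - s / smoothLength ρ α h)
      (1 - (componentLength ρ α h - s) / smoothLength ρ α h)) ∈ Icc (0 : ℝ) 1 := by
  have h1 : 0 ≤ s / smoothLength ρ α h := div_nonneg hs.1 H.smoothLength_pos.le
  have h2 : 0 ≤ (componentLength ρ α h - s) / smoothLength ρ α h :=
    div_nonneg (by linarith [hs.2]) H.smoothLength_pos.le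
  exact ⟨le_max_left _ _, max_le zero_le_one (max_le (by linarith) (by linarith))⟩

theorem continuousOn_componentCurvature (H : IsTable ρ α h) :
    ContinuousOn (componentCurvature ρ α h) (Icc 0 (componentLength ρ α h)) := by
  have h1 : ContinuousOn (fun s => h (max 0 (max (1 - s / smoothLength ρ α h)
      (1 - (componentLength ρ α h - s) / smoothLength ρ α h))) / ρ)
      (Icc 0 (componentLength ρ α h)) :=
    (H.cont.comp (Continuous.continuousOn (by fun_prop))
      (fun s hs => H.profile_arg_mem hs)).div_const ρ
  exact h1.congr fun s _ => H.componentCurvature_eq s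

theorem componentCurvature_nonneg (H : IsTable ρ α h) {s : ℝ}
    (hs : s ∈ Icc 0 (componentLength ρ α h)) : 0 ≤ componentCurvature ρ α h s := by
  rw [H.componentCurvature_eq]
  refine div_nonneg ?_ H.rho_pos.le
  have := H.anti (H.profile_arg_mem hs) (right_mem_Icc.2 zero_le_one) (H.profile_arg_mem hs).2
  rwa [H.one] at this

theorem fract_mul_mem (H : IsTable ρ α h) (s : ℝ) :
    Int.fract (s / componentLength ρ α h) * componentLength ρ α h
      ∈ Icc 0 (componentLength ρ α h) :=
  ⟨mul_nonneg (Int.fract_nonneg _) H.componentLength_pos.le,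
    mul_le_of_le_one_left H.componentLength_pos.le (Int.fract_lt_one _).le⟩

theorem curvature_nonneg (H : IsTable ρ α h) (s : ℝ) : 0 ≤ curvature ρ α h s :=
  H.componentCurvature_nonneg (H.fract_mul_mem s)

theorem componentCurvature_zero (H : IsTable ρ α h) : componentCurvature ρ α h 0 = 0 := by
  unfold componentCurvature
  rw [if_pos H.smoothLength_pos]
  simp [H.one]

theorem componentCurvature_length (H : IsTable ρ α h) :
    componentCurvature ρ α h (componentLength ρ α h) = 0 := by
  rw [← H.componentCurvature_symm, sub_self, H.componentCurvature_zero]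

/-- The periodic extension has no jump at the joints because `h 1 = 0` makes the curvature vanish at
both ends of a component. -/
theorem continuous_curvature (H : IsTable ρ α h) : Continuous (curvature ρ α h) := by
  have h1 : ContinuousOn (fun u => componentCurvature ρ α h (u * componentLength ρ α h))
      (Icc 0 1) := by
    refine H.continuousOn_componentCurvature.comp (Continuous.continuousOn (by fun_prop)) ?_
    intro u hu
    exact ⟨mul_nonneg hu.1 H.componentLength_pos.le,
      mul_le_of_le_one_left H.componentLength_pos.le hu.2⟩
  have h2 := h1.comp_fract'' (by
    simp [H.componentCurvature_zero, H.componentCurvature_length])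
  exact h2.comp (continuous_id.div_const (componentLength ρ α h))

theorem curvature_add_length (H : IsTable ρ α h) (s : ℝ) :
    curvature ρ α h (s + componentLength ρ α h) = curvature ρ α h s := by
  unfold curvature
  rw [add_div, div_self H.componentLength_pos.ne', Int.fract_add_one]

theorem curvature_neg (H : IsTable ρ α h) (s : ℝ) :
    curvature ρ α h (-s) = curvature ρ α h s := by
  unfold curvature
  rw [neg_div]
  by_cases hf : Int.fract (s / componentLength ρ α h) = 0
  · rw [hf, Int.fract_neg_eq_zero.2 hf]
  · rw [Int.fract_neg hf, ← H.componentCurvature_symm, sub_mul, one_mul, sub_sub_cancel]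

theorem curvature_eq_componentCurvature (H : IsTable ρ α h) {s : ℝ}
    (hs : s ∈ Icc 0 (componentLength ρ α h)) :
    curvature ρ α h s = componentCurvature ρ α h s := by
  rcases hs.2.eq_or_lt with h1 | h1
  · have : curvature ρ α h 0 = componentCurvature ρ α h 0 := by simp [curvature]
    rw [h1, H.componentCurvature_length, ← zero_add (componentLength ρ α h),
      H.curvature_add_length, this, H.componentCurvature_zero]
  · unfold curvature
    rw [Int.fract_eq_self.2 ⟨div_nonneg hs.1 H.componentLength_pos.le,
      (div_lt_one H.componentLength_pos).2 h1⟩, div_mul_cancel₀ _ H.componentLength_pos.ne']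

theorem curvature_of_le_smoothLength (H : IsTable ρ α h) {s : ℝ} (h0 : 0 ≤ s)
    (h1 : s ≤ smoothLength ρ α h) :
    curvature ρ α h s = h (1 - s / smoothLength ρ α h) / ρ := by
  rw [H.curvature_eq_componentCurvature ⟨h0, by
    linarith [H.two_smoothLength_lt, H.smoothLength_pos]⟩]
  unfold componentCurvature
  rcases h1.lt_or_eq with h2 | h2
  · rw [if_pos h2]
  · rw [if_neg (by linarith), if_pos (by linarith [H.two_smoothLength_lt]), h2,
      div_self H.smoothLength_pos.ne', sub_self, H.zero]

theorem curvature_of_mem_arc (H : IsTable ρ α h) {s : ℝ} (h0 : smoothLength ρ α h ≤ s)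
    (h1 : s ≤ componentLength ρ α h - smoothLength ρ α h) :
    curvature ρ α h s = 1 / ρ := by
  rw [H.curvature_eq_componentCurvature ⟨by linarith [H.smoothLength_pos], by
    linarith [H.smoothLength_pos]⟩]
  unfold componentCurvature
  rw [if_neg (by linarith), if_pos h1]

/-! ### The tangent angle -/

theorem hasStrictDerivAt_tangentAngle (H : IsTable ρ α h) (s : ℝ) :
    HasStrictDerivAt (tangentAngle ρ α h) (curvature ρ α h s) s :=
  integral_hasStrictDerivAt_right (H.continuous_curvature.intervalIntegrable _ _)
    (H.continuous_curvature.stronglyMeasurableAtFilter _ _) H.continuous_curvature.continuousAt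

theorem continuous_tangentAngle (H : IsTable ρ α h) : Continuous (tangentAngle ρ α h) :=
  continuous_iff_continuousAt.2 fun s => (H.hasStrictDerivAt_tangentAngle s).hasDerivAt.continuousAt

theorem monotone_tangentAngle (H : IsTable ρ α h) : Monotone (tangentAngle ρ α h) :=
  monotone_of_deriv_nonneg
    (fun s => (H.hasStrictDerivAt_tangentAngle s).hasDerivAt.differentiableAt)
    fun s => by
      rw [(H.hasStrictDerivAt_tangentAngle s).hasDerivAt.deriv]; exact H.curvature_nonneg s

theorem tangentAngle_neg (H : IsTable ρ α h) (s : ℝ) :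
    tangentAngle ρ α h (-s) = -tangentAngle ρ α h s := by
  unfold tangentAngle
  have := intervalIntegral.integral_comp_neg (a := 0) (b := s) (fun σ => curvature ρ α h σ)
  simp only [H.curvature_neg, neg_zero] at this
  rw [this, integral_symm]

theorem tangentAngle_smooth (H : IsTable ρ α h) {u : ℝ} (h0 : 0 ≤ u) (h1 : u ≤ 1) :
    tangentAngle ρ α h (smoothLength ρ α h * u) =
      α * ((∫ ξ in (1 - u)..1, h ξ) / ∫ ξ in (0 : ℝ)..1, h ξ) := by
  have hs := H.smoothLength_pos
  have e1 : tangentAngle ρ α h (smoothLength ρ α h * u) =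
      ∫ σ in (0 : ℝ)..(smoothLength ρ α h * u), h (1 - σ / smoothLength ρ α h) / ρ := by
    unfold tangentAngle
    apply integral_congr
    intro σ hσ
    rw [uIcc_of_le (by positivity)] at hσ
    exact H.curvature_of_le_smoothLength hσ.1
      (hσ.2.trans (mul_le_of_le_one_right hs.le h1))
  have e2 := intervalIntegral.integral_comp_sub_div (a := 0) (b := smoothLength ρ α h * u)
    (fun x => h x / ρ) hs.ne' 1
  rw [e1, e2]
  rw [mul_div_cancel_left₀ _ hs.ne', zero_div, sub_zero, intervalIntegral.integral_div]
  have := H.rho_pos.ne'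
  have := H.int_pos.ne'
  unfold smoothLength
  rw [smul_eq_mul]
  field_simp

theorem tangentAngle_smoothLength (H : IsTable ρ α h) :
    tangentAngle ρ α h (smoothLength ρ α h) = α := by
  have := H.tangentAngle_smooth zero_le_one le_rfl
  rwa [mul_one, sub_self, div_self H.int_pos.ne', mul_one] at this

theorem tangentAngle_arc (H : IsTable ρ α h) {s : ℝ} (h0 : smoothLength ρ α h ≤ s)
    (h1 : s ≤ componentLength ρ α h - smoothLength ρ α h) :
    tangentAngle ρ α h s = α + (s - smoothLength ρ α h) / ρ := by
  have hi := fun a b => H.continuous_curvature.intervalIntegrable (μ := volume) a b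
  have e1 : tangentAngle ρ α h s = tangentAngle ρ α h (smoothLength ρ α h) +
      ∫ σ in (smoothLength ρ α h)..s, curvature ρ α h σ :=
    (integral_add_adjacent_intervals (hi _ _) (hi _ _)).symm
  have e2 : ∫ σ in (smoothLength ρ α h)..s, curvature ρ α h σ =
      ∫ σ in (smoothLength ρ α h)..s, 1 / ρ := by
    apply integral_congr
    intro σ hσ
    rw [uIcc_of_le h0] at hσ
    exact H.curvature_of_mem_arc hσ.1 (hσ.2.trans h1)
  rw [e1, e2, H.tangentAngle_smoothLength, intervalIntegral.integral_const]
  simp [div_eq_mul_inv]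

theorem tangentAngle_add_length_eq (H : IsTable ρ α h) (s : ℝ) :
    tangentAngle ρ α h (s + componentLength ρ α h) =
      tangentAngle ρ α h s + tangentAngle ρ α h (componentLength ρ α h) := by
  have hi := fun a b => H.continuous_curvature.intervalIntegrable (μ := volume) a b
  have e1 : tangentAngle ρ α h (s + componentLength ρ α h) =
      tangentAngle ρ α h (componentLength ρ α h) +
      ∫ σ in (componentLength ρ α h)..(s + componentLength ρ α h), curvature ρ α h σ :=
    (integral_add_adjacent_intervals (hi _ _) (hi _ _)).symm
  have e2 := intervalIntegral.integral_comp_add_right (a := 0) (b := s)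
    (fun σ => curvature ρ α h σ) (componentLength ρ α h)
  simp only [H.curvature_add_length, zero_add] at e2
  rw [e1, ← e2, add_comm]
  rfl

/-- The angle at `componentLength - s_α` is computed twice: by periodicity and oddness, and along
the arc. -/
theorem tangentAngle_length (H : IsTable ρ α h) :
    tangentAngle ρ α h (componentLength ρ α h) = π := by
  have e1 := H.tangentAngle_add_length_eq (-smoothLength ρ α h)
  rw [H.tangentAngle_neg, H.tangentAngle_smoothLength, neg_add_eq_sub,
    H.tangentAngle_arc (by linarith [H.two_smoothLength_lt]) le_rfl] at e1
  have e2 : (componentLength ρ α h - smoothLength ρ α h - smoothLength ρ α h) / ρ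
      = π - 2 * α := by
    have := H.rho_pos.ne'
    unfold componentLength
    field_simp
    ring
  linarith

theorem tangentAngle_add_length (H : IsTable ρ α h) (s : ℝ) :
    tangentAngle ρ α h (s + componentLength ρ α h) = tangentAngle ρ α h s + π := by
  rw [H.tangentAngle_add_length_eq, H.tangentAngle_length]

theorem tangentAngle_add_perimeter (H : IsTable ρ α h) (s : ℝ) :
    tangentAngle ρ α h (s + perimeter ρ α h) = tangentAngle ρ α h s + 2 * π := by
  rw [perimeter, two_mul, ← add_assoc, H.tangentAngle_add_length, H.tangentAngle_add_length]
  ring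

theorem tangentAngle_length_sub (H : IsTable ρ α h) (s : ℝ) :
    tangentAngle ρ α h (componentLength ρ α h - s) = π - tangentAngle ρ α h s := by
  rw [sub_eq_neg_add, H.tangentAngle_add_length, H.tangentAngle_neg]
  ring

/-! ### The boundary -/

theorem hasStrictDerivAt_boundary_fst (H : IsTable ρ α h) (s : ℝ) :
    HasStrictDerivAt (fun s => (boundary ρ α h s).1) (cos (tangentAngle ρ α h s)) s := by
  have hc : Continuous fun σ => cos (tangentAngle ρ α h σ) :=
    continuous_cos.comp H.continuous_tangentAngle
  exact integral_hasStrictDerivAt_right (hc.intervalIntegrable _ _)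
    (hc.stronglyMeasurableAtFilter _ _) hc.continuousAt

theorem hasStrictDerivAt_boundary_snd (H : IsTable ρ α h) (s : ℝ) :
    HasStrictDerivAt (fun s => (boundary ρ α h s).2) (sin (tangentAngle ρ α h s)) s := by
  have hc : Continuous fun σ => sin (tangentAngle ρ α h σ) :=
    continuous_sin.comp H.continuous_tangentAngle
  exact integral_hasStrictDerivAt_right (hc.intervalIntegrable _ _)
    (hc.stronglyMeasurableAtFilter _ _) hc.continuousAt

theorem continuous_boundary_fst (H : IsTable ρ α h) :
    Continuous fun s => (boundary ρ α h s).1 :=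
  continuous_iff_continuousAt.2 fun s => (H.hasStrictDerivAt_boundary_fst s).hasDerivAt.continuousAt

theorem continuous_boundary_snd (H : IsTable ρ α h) :
    Continuous fun s => (boundary ρ α h s).2 :=
  continuous_iff_continuousAt.2 fun s => (H.hasStrictDerivAt_boundary_snd s).hasDerivAt.continuousAt

theorem boundary_zero : boundary ρ α h 0 = (0, 0) := by simp [boundary]

theorem boundary_neg (H : IsTable ρ α h) (s : ℝ) :
    boundary ρ α h (-s) = (-(boundary ρ α h s).1, (boundary ρ α h s).2) := by
  have e1 := intervalIntegral.integral_comp_neg (a := 0) (b := s)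
    (fun σ => cos (tangentAngle ρ α h σ))
  have e2 := intervalIntegral.integral_comp_neg (a := 0) (b := s)
    (fun σ => sin (tangentAngle ρ α h σ))
  simp only [H.tangentAngle_neg, cos_neg, sin_neg, neg_zero, intervalIntegral.integral_neg] at e1 e2
  unfold boundary
  rw [e1, integral_symm (-s), integral_symm (-s), ← e2]
  simp

/-- The tangent turns by `π` along a component, so the second copy is the first one rotated by a
half turn. -/
theorem boundary_add_length (H : IsTable ρ α h) (s : ℝ) :
    boundary ρ α h (s + componentLength ρ α h) =
      boundary ρ α h (componentLength ρ α h) - boundary ρ α h s := by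
  have hc : Continuous fun σ => cos (tangentAngle ρ α h σ) :=
    continuous_cos.comp H.continuous_tangentAngle
  have hs : Continuous fun σ => sin (tangentAngle ρ α h σ) :=
    continuous_sin.comp H.continuous_tangentAngle
  have e1 := intervalIntegral.integral_comp_add_right (a := 0) (b := s)
    (fun σ => cos (tangentAngle ρ α h σ)) (componentLength ρ α h)
  have e2 := intervalIntegral.integral_comp_add_right (a := 0) (b := s)
    (fun σ => sin (tangentAngle ρ α h σ)) (componentLength ρ α h)
  simp only [H.tangentAngle_add_length, cos_add_pi, sin_add_pi, zero_add,
    intervalIntegral.integral_neg] at e1 e2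
  unfold boundary
  rw [← integral_add_adjacent_intervals (hc.intervalIntegrable 0 (componentLength ρ α h))
      (hc.intervalIntegrable _ (s + componentLength ρ α h)),
    ← integral_add_adjacent_intervals (hs.intervalIntegrable 0 (componentLength ρ α h))
      (hs.intervalIntegrable _ (s + componentLength ρ α h)), ← e1, ← e2]
  simp [sub_eq_add_neg]

theorem boundary_length_fst (H : IsTable ρ α h) :
    (boundary ρ α h (componentLength ρ α h)).1 = 0 := by
  have e1 := congrArg Prod.fst (H.boundary_add_length (-componentLength ρ α h))
  rw [neg_add_cancel, boundary_zero, Prod.fst_sub, H.boundary_neg] at e1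
  simp only [] at e1
  linarith

theorem boundary_length_sub (H : IsTable ρ α h) (s : ℝ) :
    boundary ρ α h (componentLength ρ α h - s) = ((boundary ρ α h s).1,
      (boundary ρ α h (componentLength ρ α h)).2 - (boundary ρ α h s).2) := by
  rw [sub_eq_neg_add, H.boundary_add_length, H.boundary_neg]
  ext
  · simp [H.boundary_length_fst]
  · simp

end IsTable

end Curvature

/-! ### One flight: uniqueness of the landing point and derivative of the billiard map. -/

section Steps

variable {ρ α : ℝ} {h : ℝ → ℝ} {x y z : ℝ × ℝ}

/-- Angle of the velocity which leaves the boundary in the state `x`. -/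
noncomputable def outAngle (ρ α : ℝ) (h : ℝ → ℝ) (x : ℝ × ℝ) : ℝ := tangentAngle ρ α h x.1 + π / 2 - x.2

/-- Angle of the velocity whose reflection gives the state `y`. -/
noncomputable def inAngle (ρ α : ℝ) (h : ℝ → ℝ) (y : ℝ × ℝ) : ℝ := tangentAngle ρ α h y.1 - π / 2 + y.2

theorem cos_outAngle (x : ℝ × ℝ) : cos (outAngle ρ α h x) =
    sin x.2 * cos (tangentAngle ρ α h x.1) - cos x.2 * sin (tangentAngle ρ α h x.1) := by
  rw [outAngle, show tangentAngle ρ α h x.1 + π / 2 - x.2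
    = π / 2 - (x.2 - tangentAngle ρ α h x.1) by ring, cos_pi_div_two_sub, sin_sub]

theorem sin_outAngle (x : ℝ × ℝ) : sin (outAngle ρ α h x) =
    sin x.2 * sin (tangentAngle ρ α h x.1) + cos x.2 * cos (tangentAngle ρ α h x.1) := by
  rw [outAngle, show tangentAngle ρ α h x.1 + π / 2 - x.2
    = π / 2 - (x.2 - tangentAngle ρ α h x.1) by ring, sin_pi_div_two_sub, cos_sub]
  ring

theorem cos_inAngle (y : ℝ × ℝ) : cos (inAngle ρ α h y) =
    sin y.2 * cos (tangentAngle ρ α h y.1) + cos y.2 * sin (tangentAngle ρ α h y.1) := by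
  rw [inAngle, show tangentAngle ρ α h y.1 - π / 2 + y.2
    = y.2 + tangentAngle ρ α h y.1 - π / 2 by ring, cos_sub_pi_div_two, sin_add]

theorem sin_inAngle (y : ℝ × ℝ) : sin (inAngle ρ α h y) =
    sin y.2 * sin (tangentAngle ρ α h y.1) - cos y.2 * cos (tangentAngle ρ α h y.1) := by
  rw [inAngle, show tangentAngle ρ α h y.1 - π / 2 + y.2
    = y.2 + tangentAngle ρ α h y.1 - π / 2 by ring, sin_sub_pi_div_two, cos_add]
  ring

/-- The relation between consecutive states with a flight of length `τ`. -/
structure IsFlight (ρ α : ℝ) (h : ℝ → ℝ) (τ : ℝ) (x y : ℝ × ℝ) : Prop where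
  abs_left : |x.2| < π / 2
  abs_right : |y.2| < π / 2
  lt : x.1 < y.1
  lt_add : y.1 < x.1 + perimeter ρ α h
  pos : 0 < τ
  fst : (boundary ρ α h y.1).1 - (boundary ρ α h x.1).1 = τ * cos (outAngle ρ α h x)
  snd : (boundary ρ α h y.1).2 - (boundary ρ α h x.1).2 = τ * sin (outAngle ρ α h x)
  cos_eq : cos (inAngle ρ α h y) = cos (outAngle ρ α h x)
  sin_eq : sin (inAngle ρ α h y) = sin (outAngle ρ α h x)

theorem isStep_iff : IsStep ρ α h x y ↔ ∃ τ, IsFlight ρ α h τ x y := by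
  have e1 : sin x.2 • tangent ρ α h x.1 + cos x.2 • normal ρ α h x.1 =
      (cos (outAngle ρ α h x), sin (outAngle ρ α h x)) := by
    rw [cos_outAngle, sin_outAngle]
    ext <;> simp [tangent, normal, sub_eq_add_neg]
  have e2 : sin y.2 • tangent ρ α h y.1 - cos y.2 • normal ρ α h y.1 =
      (cos (inAngle ρ α h y), sin (inAngle ρ α h y)) := by
    rw [cos_inAngle, sin_inAngle]
    ext <;> simp [tangent, normal]
  unfold IsStep
  rw [e1, e2]
  constructor
  · rintro ⟨h1, h2, h3, h4, τ, h5, h6, h7⟩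
    rw [h6] at h7
    have h8 := smul_right_injective (ℝ × ℝ) h5.ne' h7
    simp only [Prod.mk.injEq] at h8
    refine ⟨τ, h1, h2, h3, h4, h5, ?_, ?_, h8.1.symm, h8.2.symm⟩
    · simpa using congrArg Prod.fst h6
    · simpa using congrArg Prod.snd h6
  · rintro ⟨τ, H⟩
    have h6 : boundary ρ α h y.1 - boundary ρ α h x.1 =
        τ • (cos (outAngle ρ α h x), sin (outAngle ρ α h x)) := by
      ext
      · simpa using H.fst
      · simpa using H.snd
    refine ⟨H.abs_left, H.abs_right, H.lt, H.lt_add, τ, H.pos, h6, ?_⟩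
    rw [h6, H.cos_eq, H.sin_eq]

theorem cos_pos_of_abs_lt {φ : ℝ} (hφ : |φ| < π / 2) : 0 < cos φ :=
  cos_pos_of_mem_Ioo ⟨by linarith [(abs_lt.1 hφ).1], (abs_lt.1 hφ).2⟩

theorem IsFlight.sin_tangentAngle_sub {τ : ℝ} (hf : IsFlight ρ α h τ x y) :
    sin (tangentAngle ρ α h y.1 - outAngle ρ α h x) = cos y.2 := by
  rw [sin_sub, ← hf.cos_eq, ← hf.sin_eq, ← sin_sub, inAngle,
    show tangentAngle ρ α h y.1 - (tangentAngle ρ α h y.1 - π / 2 + y.2) = π / 2 - y.2 by ring,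
    sin_pi_div_two_sub]

theorem IsFlight.cos_tangentAngle_sub {τ : ℝ} (hf : IsFlight ρ α h τ x y) :
    cos (tangentAngle ρ α h y.1 - outAngle ρ α h x) = sin y.2 := by
  rw [cos_sub, ← hf.cos_eq, ← hf.sin_eq, ← cos_sub, inAngle,
    show tangentAngle ρ α h y.1 - (tangentAngle ρ α h y.1 - π / 2 + y.2) = π / 2 - y.2 by ring,
    cos_pi_div_two_sub]

/-- Since a landing parameter is less than one perimeter ahead, the difference lies in `(-π, 2π)`;
its sine is `cos y.2 > 0`, which leaves only `(0, π)`. -/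
theorem IsFlight.tangentAngle_sub_mem (H : IsTable ρ α h) {τ : ℝ} (hf : IsFlight ρ α h τ x y) :
    tangentAngle ρ α h y.1 - outAngle ρ α h x ∈ Ioo 0 π := by
  have h1 := hf.sin_tangentAngle_sub
  have h2 := cos_pos_of_abs_lt hf.abs_right
  have h3 := H.monotone_tangentAngle hf.lt.le
  have h4 := H.monotone_tangentAngle hf.lt_add.le
  rw [H.tangentAngle_add_perimeter] at h4
  have h5 := abs_lt.1 hf.abs_left
  have h6 : -π < tangentAngle ρ α h y.1 - outAngle ρ α h x := by
    unfold outAngle; linarith [h5.1]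
  have h7 : tangentAngle ρ α h y.1 - outAngle ρ α h x < 2 * π := by
    unfold outAngle; linarith [h5.2]
  set t := tangentAngle ρ α h y.1 - outAngle ρ α h x
  constructor
  · by_contra hc
    have := sin_nonpos_of_nonpos_of_neg_pi_le (not_lt.1 hc) h6.le
    linarith
  · by_contra hc
    have h8 : sin (t - π) = -sin t := sin_sub_pi t
    have := sin_nonneg_of_nonneg_of_le_pi (x := t - π) (by linarith [not_lt.1 hc]) (by linarith)
    linarith

/-- If there were a later landing point, the signed distance `f` from the line of flight would be
strictly increasing between the two, since there the boundary crosses that direction at an angle in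
`(0, π)`. But `f` takes the same value at both. -/
theorem IsFlight.fst_le (H : IsTable ρ α h) {τ τ' : ℝ} (hy : IsFlight ρ α h τ x y)
    (hz : IsFlight ρ α h τ' x z) : z.1 ≤ y.1 := by
  by_contra! hlt
  set ψ := outAngle ρ α h x with hψ
  let f : ℝ → ℝ := fun s => (boundary ρ α h s).2 * cos ψ - (boundary ρ α h s).1 * sin ψ
  have hd : ∀ s, HasDerivAt f (sin (tangentAngle ρ α h s - ψ)) s := by
    intro s
    have := ((H.hasStrictDerivAt_boundary_snd s).hasDerivAt.mul_const (cos ψ)).sub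
      ((H.hasStrictDerivAt_boundary_fst s).hasDerivAt.mul_const (sin ψ))
    rw [sin_sub]
    exact this
  have hmono : StrictMonoOn f (Icc y.1 z.1) := by
    apply strictMonoOn_of_deriv_pos (convex_Icc _ _)
    · exact fun s _ => (hd s).continuousAt.continuousWithinAt
    · intro s hs
      rw [interior_Icc] at hs
      rw [(hd s).deriv]
      have h1 := hy.tangentAngle_sub_mem H
      have h2 := hz.tangentAngle_sub_mem H
      have h3 := H.monotone_tangentAngle hs.1.le
      have h4 := H.monotone_tangentAngle hs.2.le
      exact sin_pos_of_pos_of_lt_pi (by linarith [h1.1]) (by linarith [h2.2])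
  have h1 : f y.1 = f x.1 := by
    have e1 := hy.fst
    have e2 := hy.snd
    simp only [f]
    linear_combination cos ψ * e2 - sin ψ * e1
  have h2 : f z.1 = f x.1 := by
    have e1 := hz.fst
    have e2 := hz.snd
    simp only [f]
    linear_combination cos ψ * e2 - sin ψ * e1
  have h3 := hmono (left_mem_Icc.2 hlt.le) (right_mem_Icc.2 hlt.le) hlt
  linarith

theorem IsFlight.unique (H : IsTable ρ α h) {τ τ' : ℝ} (hy : IsFlight ρ α h τ x y)
    (hz : IsFlight ρ α h τ' x z) : y = z := by
  have h1 : y.1 = z.1 := le_antisymm (hz.fst_le H hy) (hy.fst_le H hz)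
  have h2 : sin y.2 = sin z.2 := by
    rw [← hy.cos_tangentAngle_sub, ← hz.cos_tangentAngle_sub, h1]
  have h3 := abs_lt.1 hy.abs_right
  have h4 := abs_lt.1 hz.abs_right
  exact Prod.ext h1 (injOn_sin ⟨by linarith [h3.1], h3.2.le⟩ ⟨by linarith [h4.1], h4.2.le⟩ h2)

/-- Uniqueness of the landing state makes the choice in `billiardMap` harmless. -/
theorem IsFlight.billiardMap_eq (H : IsTable ρ α h) {τ : ℝ} (hy : IsFlight ρ α h τ x y) :
    billiardMap ρ α h x = y := by
  have hx : ∃ y, IsStep ρ α h x y := ⟨y, isStep_iff.2 ⟨τ, hy⟩⟩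
  obtain ⟨τ', hz⟩ := isStep_iff.1 hx.choose_spec
  rw [billiardMap, dif_pos hx]
  exact hz.unique H hy

/-- The linear map of the plane with matrix `!![a, b; c, d]`. -/
def planeMap (a b c d : ℝ) : ℝ × ℝ →L[ℝ] ℝ × ℝ :=
  (a • ContinuousLinearMap.fst ℝ ℝ ℝ + b • ContinuousLinearMap.snd ℝ ℝ ℝ).prod
    (c • ContinuousLinearMap.fst ℝ ℝ ℝ + d • ContinuousLinearMap.snd ℝ ℝ ℝ)

@[simp] theorem planeMap_apply (a b c d : ℝ) (v : ℝ × ℝ) :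
    planeMap a b c d v = (a * v.1 + b * v.2, c * v.1 + d * v.2) := by
  simp [planeMap]

theorem planeMap_comp (a b c d a' b' c' d' : ℝ) :
    (planeMap a b c d).comp (planeMap a' b' c' d') =
      planeMap (a * a' + b * c') (a * b' + b * d') (c * a' + d * c') (c * b' + d * d') := by
  ext <;> simp

theorem toMatrix_planeMap (a b c d : ℝ) :
    LinearMap.toMatrix (Module.Basis.finTwoProd ℝ) (Module.Basis.finTwoProd ℝ)
      (planeMap a b c d : ℝ × ℝ →ₗ[ℝ] ℝ × ℝ) = !![a, b; c, d] := by
  ext i j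
  fin_cases i <;> fin_cases j <;> simp [LinearMap.toMatrix_apply]

theorem det_planeMap (a b c d : ℝ) :
    LinearMap.det (planeMap a b c d : ℝ × ℝ →ₗ[ℝ] ℝ × ℝ) = a * d - b * c := by
  rw [← LinearMap.det_toMatrix (Module.Basis.finTwoProd ℝ), toMatrix_planeMap,
    Matrix.det_fin_two_of]

theorem trace_planeMap (a b c d : ℝ) :
    LinearMap.trace ℝ (ℝ × ℝ) (planeMap a b c d : ℝ × ℝ →ₗ[ℝ] ℝ × ℝ) = a + d := by
  rw [LinearMap.trace_eq_matrix_trace ℝ (Module.Basis.finTwoProd ℝ), toMatrix_planeMap,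
    Matrix.trace_fin_two_of]

/-- The derivative of the billiard map in terms of the curvatures `k₀, k₁` and the cosines
`c₀, c₁` of the angles of reflection at both ends of the flight, and of its length `τ`. -/
noncomputable def stepDeriv (k₀ k₁ c₀ c₁ τ : ℝ) : ℝ × ℝ →L[ℝ] ℝ × ℝ :=
  planeMap ((τ * k₀ - c₀) / c₁) (-τ / c₁) (k₀ - k₁ * ((τ * k₀ - c₀) / c₁)) (-1 + k₁ * τ / c₁)

/-- Signed distance of the boundary point `v.2` from the line along which the state `v.1`
moves. -/
noncomputable def lineDist (ρ α : ℝ) (h : ℝ → ℝ) (v : (ℝ × ℝ) × ℝ) : ℝ :=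
  ((boundary ρ α h v.2).2 - (boundary ρ α h v.1.1).2) * cos (outAngle ρ α h v.1) -
    ((boundary ρ α h v.2).1 - (boundary ρ α h v.1.1).1) * sin (outAngle ρ α h v.1)

theorem hasStrictFDerivAt_outAngle (H : IsTable ρ α h) (x : ℝ × ℝ) :
    HasStrictFDerivAt (outAngle ρ α h) (curvature ρ α h x.1 • ContinuousLinearMap.fst ℝ ℝ ℝ -
      ContinuousLinearMap.snd ℝ ℝ ℝ) x :=
  (((H.hasStrictDerivAt_tangentAngle x.1).comp_hasStrictFDerivAt x hasStrictFDerivAt_fst).add_const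
    (π / 2)).sub hasStrictFDerivAt_snd

/-- The landing point is the zero of `lineDist` in its last variable. The coefficient `cos y.2` of
that variable measures transversality. -/
theorem IsFlight.hasStrictFDerivAt_lineDist (H : IsTable ρ α h) {τ : ℝ}
    (hf : IsFlight ρ α h τ x y) :
    HasStrictFDerivAt (lineDist ρ α h)
      (((cos x.2 - τ * curvature ρ α h x.1) • ContinuousLinearMap.fst ℝ ℝ ℝ +
        τ • ContinuousLinearMap.snd ℝ ℝ ℝ).comp (ContinuousLinearMap.fst ℝ (ℝ × ℝ) ℝ) +
        cos y.2 • ContinuousLinearMap.snd ℝ (ℝ × ℝ) ℝ) (x, y.1) := by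
  have d0 : HasStrictFDerivAt (fun v : (ℝ × ℝ) × ℝ => v.1) (ContinuousLinearMap.fst ℝ (ℝ × ℝ) ℝ)
    (x, y.1) := hasStrictFDerivAt_fst
  have d1 : HasStrictFDerivAt (fun v : (ℝ × ℝ) × ℝ => v.2) (ContinuousLinearMap.snd ℝ (ℝ × ℝ) ℝ)
    (x, y.1) := hasStrictFDerivAt_snd
  have d2 : HasStrictFDerivAt (fun v : (ℝ × ℝ) × ℝ => v.1.1) ((ContinuousLinearMap.fst ℝ ℝ ℝ).comp
    (ContinuousLinearMap.fst ℝ (ℝ × ℝ) ℝ)) (x, y.1) := hasStrictFDerivAt_fst.comp _ d0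
  have dψ : HasStrictFDerivAt (fun v : (ℝ × ℝ) × ℝ => outAngle ρ α h v.1) _ (x, y.1) :=
    (hasStrictFDerivAt_outAngle H x).comp (x, y.1) d0
  have b1 := (H.hasStrictDerivAt_boundary_fst y.1).comp_hasStrictFDerivAt (x, y.1) d1
  have b2 := (H.hasStrictDerivAt_boundary_snd y.1).comp_hasStrictFDerivAt (x, y.1) d1
  have b3 := (H.hasStrictDerivAt_boundary_fst x.1).comp_hasStrictFDerivAt (x, y.1) d2
  have b4 := (H.hasStrictDerivAt_boundary_snd x.1).comp_hasStrictFDerivAt (x, y.1) d2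
  have hc := (hasStrictDerivAt_cos (outAngle ρ α h x)).comp_hasStrictFDerivAt (x, y.1) dψ
  have hs := (hasStrictDerivAt_sin (outAngle ρ α h x)).comp_hasStrictFDerivAt (x, y.1) dψ
  have key := ((b2.sub b4).mul hc).sub ((b1.sub b3).mul hs)
  refine HasStrictFDerivAt.congr_fderiv (f := lineDist ρ α h) key ?_
  have e1 := hf.sin_tangentAngle_sub
  have e2 : sin (outAngle ρ α h x - tangentAngle ρ α h x.1) = cos x.2 := by
    rw [outAngle, show tangentAngle ρ α h x.1 + π / 2 - x.2 - tangentAngle ρ α h x.1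
      = π / 2 - x.2 by ring, sin_pi_div_two_sub]
  have e3 := hf.fst
  have e4 := hf.snd
  have e5 := sin_sq_add_cos_sq (outAngle ρ α h x)
  rw [sin_sub] at e1 e2
  ext
  · simp
    rw [e3, e4]
    linear_combination e2 - τ * curvature ρ α h x.1 * e5
  · simp
    rw [e3, e4]
    linear_combination τ * e5
  · simp
    linear_combination e1

theorem isInvertible_of_apply_one {L : ℝ →L[ℝ] ℝ} (hL : L 1 ≠ 0) : L.IsInvertible :=
  ⟨ContinuousLinearEquiv.unitsEquivAut ℝ (Units.mk0 (L 1) hL), by ext; simp⟩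

/-- The billiard map is differentiable at the start of a flight, with the classical
derivative. -/
theorem IsFlight.hasFDerivAt (H : IsTable ρ α h) {τ : ℝ} (hf : IsFlight ρ α h τ x y) :
    HasFDerivAt (billiardMap ρ α h)
      (stepDeriv (curvature ρ α h x.1) (curvature ρ α h y.1) (cos x.2) (cos y.2) τ) x := by
  have hc1 := (cos_pos_of_abs_lt hf.abs_right).ne'
  have hd := hf.hasStrictFDerivAt_lineDist H
  set D := (((cos x.2 - τ * curvature ρ α h x.1) • ContinuousLinearMap.fst ℝ ℝ ℝ +
        τ • ContinuousLinearMap.snd ℝ ℝ ℝ).comp (ContinuousLinearMap.fst ℝ (ℝ × ℝ) ℝ) +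
        cos y.2 • ContinuousLinearMap.snd ℝ (ℝ × ℝ) ℝ) with hD
  -- The flight arrives transversally, `cos y.2 ≠ 0`, so the implicit function theorem gives the
  -- landing parameter `g`.
  have hinv : (D ∘L .inr ℝ (ℝ × ℝ) ℝ).IsInvertible :=
    isInvertible_of_apply_one (by simpa [hD] using hc1)
  have hg := (hd.hasStrictFDerivAt_implicitFunctionOfProdDomain hinv).hasFDerivAt
  have hg0 := hd.tendsto_implicitFunctionOfProdDomain hinv
  have hgz := hd.eventually_apply_implicitFunctionOfProdDomain hinv
  set g := hd.implicitFunctionOfProdDomain hinv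
  simp only at hg hg0 hgz
  have hgx : g x = y.1 := tendsto_nhds_unique hg.continuousAt hg0
  have hg' : HasFDerivAt g (((τ * curvature ρ α h x.1 - cos x.2) / cos y.2) •
      ContinuousLinearMap.fst ℝ ℝ ℝ + (-τ / cos y.2) • ContinuousLinearMap.snd ℝ ℝ ℝ) x := by
    refine hg.congr_fderiv ?_
    have hL : ∀ v : ℝ × ℝ, cos y.2 * ((D ∘L .inr ℝ (ℝ × ℝ) ℝ).inverse (D (v, 0))) = D (v, 0) := by
      intro v
      have := hinv.self_apply_inverse (D (v, 0))
      simpa [hD] using this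
    have hL' : ∀ v : ℝ × ℝ, (D ∘L .inr ℝ (ℝ × ℝ) ℝ).inverse (D (v, 0)) = D (v, 0) / cos y.2 :=
      fun v => by rw [eq_div_iff hc1, mul_comm]; exact hL v
    refine ContinuousLinearMap.ext fun v => ?_
    have e := hL' v
    have e' : (-(D ∘L .inr ℝ (ℝ × ℝ) ℝ).inverse ∘L (D ∘L .inl ℝ (ℝ × ℝ) ℝ)) v =
        -((D ∘L .inr ℝ (ℝ × ℝ) ℝ).inverse (D (v, 0))) := by simp
    rw [e', e]
    simp [hD]
    field_simp
    ring
  -- the reflected angle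
  let ψ := fun x' => y.2 + (outAngle ρ α h x' - outAngle ρ α h x) -
    (tangentAngle ρ α h (g x') - tangentAngle ρ α h y.1)
  have hθ : HasDerivAt (tangentAngle ρ α h) (curvature ρ α h y.1) (g x) := by
    rw [hgx]; exact (H.hasStrictDerivAt_tangentAngle y.1).hasDerivAt
  have hψ : HasFDerivAt ψ ((curvature ρ α h x.1 • ContinuousLinearMap.fst ℝ ℝ ℝ -
      ContinuousLinearMap.snd ℝ ℝ ℝ) - curvature ρ α h y.1 •
      (((τ * curvature ρ α h x.1 - cos x.2) / cos y.2) •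
      ContinuousLinearMap.fst ℝ ℝ ℝ + (-τ / cos y.2) • ContinuousLinearMap.snd ℝ ℝ ℝ)) x :=
    (((hasStrictFDerivAt_outAngle H x).hasFDerivAt.sub_const _).const_add y.2).sub
      ((hθ.comp_hasFDerivAt x hg').sub_const _)
  have hG := hg'.prodMk hψ
  have hGx : ψ x = y.2 := by simp [ψ, hgx]
  -- nearby states
  have hev : (billiardMap ρ α h) =ᶠ[𝓝 x] fun x' => (g x', ψ x') := by
    have c1 : ContinuousAt (fun x' : ℝ × ℝ => x'.2) x := continuous_snd.continuousAt
    have c0 : ContinuousAt (fun x' : ℝ × ℝ => x'.1) x := continuous_fst.continuousAt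
    have cB1 : ContinuousAt (fun x' => (boundary ρ α h (g x')).1) x :=
      H.continuous_boundary_fst.continuousAt.comp hg.continuousAt
    have cB2 : ContinuousAt (fun x' => (boundary ρ α h (g x')).2) x :=
      H.continuous_boundary_snd.continuousAt.comp hg.continuousAt
    have cB3 : ContinuousAt (fun x' : ℝ × ℝ => (boundary ρ α h x'.1).1) x :=
      H.continuous_boundary_fst.continuousAt.comp c0
    have cB4 : ContinuousAt (fun x' : ℝ × ℝ => (boundary ρ α h x'.1).2) x :=
      H.continuous_boundary_snd.continuousAt.comp c0
    have cψ := (hasStrictFDerivAt_outAngle H x).hasFDerivAt.continuousAt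
    let T := fun x' : ℝ × ℝ => ((boundary ρ α h (g x')).1 - (boundary ρ α h x'.1).1) *
        cos (outAngle ρ α h x') +
      ((boundary ρ α h (g x')).2 - (boundary ρ α h x'.1).2) * sin (outAngle ρ α h x')
    have cT : ContinuousAt T x :=
      ((cB1.sub cB3).mul (continuous_cos.continuousAt.comp cψ)).add
        ((cB2.sub cB4).mul (continuous_sin.continuousAt.comp cψ))
    have hTx : T x = τ := by
      simp only [T]
      rw [hgx, hf.fst, hf.snd]
      linear_combination τ * sin_sq_add_cos_sq (outAngle ρ α h x)
    have ev1 : ∀ᶠ x' in 𝓝 x, |x'.2| < π / 2 :=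
      c1.abs.eventually_lt continuousAt_const hf.abs_left
    have ev2 : ∀ᶠ x' in 𝓝 x, |ψ x'| < π / 2 :=
      hψ.continuousAt.abs.eventually_lt continuousAt_const (by rw [hGx]; exact hf.abs_right)
    have ev3 : ∀ᶠ x' : ℝ × ℝ in 𝓝 x, x'.1 < g x' :=
      c0.eventually_lt hg.continuousAt (by rw [hgx]; exact hf.lt)
    have ev4 : ∀ᶠ x' : ℝ × ℝ in 𝓝 x, g x' < x'.1 + perimeter ρ α h :=
      hg.continuousAt.eventually_lt (c0.add continuousAt_const) (by rw [hgx]; exact hf.lt_add)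
    have ev5 : ∀ᶠ x' : ℝ × ℝ in 𝓝 x, 0 < T x' :=
      continuousAt_const.eventually_lt cT (by rw [hTx]; exact hf.pos)
    have hz0 : lineDist ρ α h (x, y.1) = 0 := by
      simp only [lineDist]
      rw [hf.fst, hf.snd]
      ring
    filter_upwards [ev1, ev2, ev3, ev4, ev5, hgz] with x' e1 e2 e3 e4 e5 e6
    rw [hz0] at e6
    have e7 := sin_sq_add_cos_sq (outAngle ρ α h x')
    -- Incoming and outgoing angles may differ by a multiple of `2π`. By `e9` and `e10` this fixed
    -- offset does not affect sines and cosines.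
    have e8 : inAngle ρ α h (g x', ψ x') =
        outAngle ρ α h x' + (inAngle ρ α h y - outAngle ρ α h x) := by
      simp only [inAngle, ψ]; ring
    have e9 : cos (inAngle ρ α h y - outAngle ρ α h x) = 1 := by
      rw [cos_sub, hf.cos_eq, hf.sin_eq]
      linear_combination sin_sq_add_cos_sq (outAngle ρ α h x)
    have e10 : sin (inAngle ρ α h y - outAngle ρ α h x) = 0 := by
      rw [sin_sub, hf.cos_eq, hf.sin_eq]
      ring
    refine IsFlight.billiardMap_eq H (τ := T x') ⟨e1, e2, e3, e4, e5, ?_, ?_, ?_, ?_⟩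
    · simp only [lineDist] at e6
      simp only [T]
      linear_combination (-sin (outAngle ρ α h x')) * e6 -
        ((boundary ρ α h (g x')).1 - (boundary ρ α h x'.1).1) * e7
    · simp only [lineDist] at e6
      simp only [T]
      linear_combination (cos (outAngle ρ α h x')) * e6 -
        ((boundary ρ α h (g x')).2 - (boundary ρ α h x'.1).2) * e7
    · rw [e8, cos_add, e9, e10]; ring
    · rw [e8, sin_add, e9, e10]; ring
  refine (hG.congr_of_eventuallyEq hev).congr_fderiv ?_
  ext <;> simp [stepDeriv]
  ring

end Steps

/-! ### Chains of flights, periodicity, and the circular arc. -/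

section Chains

variable {ρ α : ℝ} {h : ℝ → ℝ} {x y z : ℝ × ℝ}

theorem IsFlight.shift (H : IsTable ρ α h) {τ : ℝ} (hf : IsFlight ρ α h τ x y) :
    IsFlight ρ α h τ (x.1 + componentLength ρ α h, x.2) (y.1 + componentLength ρ α h, y.2) := by
  have e1 : outAngle ρ α h (x.1 + componentLength ρ α h, x.2) = outAngle ρ α h x + π := by
    simp only [outAngle, H.tangentAngle_add_length]; ring
  have e2 : inAngle ρ α h (y.1 + componentLength ρ α h, y.2) = inAngle ρ α h y + π := by
    simp only [inAngle, H.tangentAngle_add_length]; ring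
  refine ⟨hf.abs_left, hf.abs_right, by simpa using hf.lt, ?_, hf.pos, ?_, ?_, ?_, ?_⟩
  · simp only []; linarith [hf.lt_add]
  · rw [e1, cos_add_pi, H.boundary_add_length, H.boundary_add_length]
    simp only [Prod.fst_sub]; linarith [hf.fst]
  · rw [e1, sin_add_pi, H.boundary_add_length, H.boundary_add_length]
    simp only [Prod.snd_sub]; linarith [hf.snd]
  · rw [e1, e2, cos_add_pi, cos_add_pi, hf.cos_eq]
  · rw [e1, e2, sin_add_pi, sin_add_pi, hf.sin_eq]

/-- Reflection in the axis through the midpoints of the two components reverses flights. -/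
theorem IsFlight.reflect (H : IsTable ρ α h) {τ : ℝ} (hf : IsFlight ρ α h τ x y) :
    IsFlight ρ α h τ (componentLength ρ α h - y.1, y.2) (componentLength ρ α h - x.1, x.2) := by
  have e1 : outAngle ρ α h (componentLength ρ α h - y.1, y.2) = π - inAngle ρ α h y := by
    simp only [outAngle, inAngle, H.tangentAngle_length_sub]; ring
  have e2 : inAngle ρ α h (componentLength ρ α h - x.1, x.2) = π - outAngle ρ α h x := by
    simp only [inAngle, outAngle, H.tangentAngle_length_sub]; ring
  refine ⟨hf.abs_right, hf.abs_left, by simpa using hf.lt, ?_, hf.pos, ?_, ?_, ?_, ?_⟩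
  · simp only []; linarith [hf.lt_add]
  · rw [e1, cos_pi_sub, hf.cos_eq, H.boundary_length_sub, H.boundary_length_sub]
    simp only []; linarith [hf.fst]
  · rw [e1, sin_pi_sub, hf.sin_eq, H.boundary_length_sub, H.boundary_length_sub]
    simp only []; linarith [hf.snd]
  · rw [e1, e2, cos_pi_sub, cos_pi_sub, hf.cos_eq]
  · rw [e1, e2, sin_pi_sub, sin_pi_sub, hf.sin_eq]

/-- `FlightChain ρ α h k x y M`: there are `k` consecutive flights from `x` to `y`, and `M` is the
product of their derivatives. -/
inductive FlightChain (ρ α : ℝ) (h : ℝ → ℝ) :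
    ℕ → ℝ × ℝ → ℝ × ℝ → (ℝ × ℝ →L[ℝ] ℝ × ℝ) → Prop
  | refl (x : ℝ × ℝ) : FlightChain ρ α h 0 x x (ContinuousLinearMap.id ℝ (ℝ × ℝ))
  | step {k : ℕ} {x y z : ℝ × ℝ} {M : ℝ × ℝ →L[ℝ] ℝ × ℝ} {τ : ℝ}
      (hc : FlightChain ρ α h k x y M) (hf : IsFlight ρ α h τ y z) :
      FlightChain ρ α h (k + 1) x z
        ((stepDeriv (curvature ρ α h y.1) (curvature ρ α h z.1) (cos y.2) (cos z.2) τ).comp M)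

theorem FlightChain.trans {k l : ℕ} {M M' : ℝ × ℝ →L[ℝ] ℝ × ℝ} (h1 : FlightChain ρ α h k x y M)
    (h2 : FlightChain ρ α h l y z M') : FlightChain ρ α h (k + l) x z (M'.comp M) := by
  induction h2 with
  | refl => simpa using h1
  | step _ hf ih => exact (ih h1).step hf

theorem IsFlight.chain {τ : ℝ} (hf : IsFlight ρ α h τ x y) :
    FlightChain ρ α h 1 x y
      (stepDeriv (curvature ρ α h x.1) (curvature ρ α h y.1) (cos x.2) (cos y.2) τ) := by
  simpa using (FlightChain.refl x).step hf

theorem FlightChain.shift (H : IsTable ρ α h) {k : ℕ} {M : ℝ × ℝ →L[ℝ] ℝ × ℝ}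
    (hc : FlightChain ρ α h k x y M) :
    FlightChain ρ α h k (x.1 + componentLength ρ α h, x.2) (y.1 + componentLength ρ α h, y.2)
      M := by
  induction hc with
  | refl => exact FlightChain.refl _
  | step _ hf ih => simpa [H.curvature_add_length] using ih.step (hf.shift H)

theorem FlightChain.iterate_eq (H : IsTable ρ α h) {k : ℕ} {M : ℝ × ℝ →L[ℝ] ℝ × ℝ}
    (hc : FlightChain ρ α h k x y M) : (billiardMap ρ α h)^[k] x = y := by
  induction hc with
  | refl => rfl
  | step _ hf ih => rw [Function.iterate_succ_apply', ih, hf.billiardMap_eq H]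

theorem FlightChain.hasFDerivAt (H : IsTable ρ α h) {k : ℕ} {M : ℝ × ℝ →L[ℝ] ℝ × ℝ}
    (hc : FlightChain ρ α h k x y M) : HasFDerivAt ((billiardMap ρ α h)^[k]) M x := by
  induction hc with
  | refl => exact hasFDerivAt_id _
  | step hc hf ih =>
    rw [Function.iterate_succ']
    refine HasFDerivAt.comp _ ?_ ih
    rw [hc.iterate_eq H]
    exact hf.hasFDerivAt H

theorem FlightChain.iterate_fst_lt (H : IsTable ρ α h) {k : ℕ} {M : ℝ × ℝ →L[ℝ] ℝ × ℝ}
    (hc : FlightChain ρ α h k x y M) :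
    ∀ q < k, ((billiardMap ρ α h)^[q] x).1 < ((billiardMap ρ α h)^[q + 1] x).1 := by
  induction hc with
  | refl => simp
  | step hc hf ih =>
    intro q hq
    rcases Nat.lt_succ_iff_lt_or_eq.1 hq with h1 | rfl
    · exact ih q h1
    · rw [Function.iterate_succ_apply', hc.iterate_eq H, hf.billiardMap_eq H]
      exact hf.lt

/-- A chain of flights around the table once is a periodic orbit. -/
theorem FlightChain.isPeriodicState (H : IsTable ρ α h) {k : ℕ} {M : ℝ × ℝ →L[ℝ] ℝ × ℝ}
    (hk : 0 < k) (hx : |x.2| < π / 2)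
    (hc : FlightChain ρ α h k x (x.1 + perimeter ρ α h, x.2) M) :
    IsPeriodicState ρ α h k x := by
  have hmono : ∀ q r, q ≤ r → r ≤ k →
      ((billiardMap ρ α h)^[q] x).1 ≤ ((billiardMap ρ α h)^[r] x).1 := by
    intro q r hqr
    induction r, hqr using Nat.le_induction with
    | base => intro _; exact le_rfl
    | succ r _ ih =>
      intro hr
      exact (ih (by omega)).trans (hc.iterate_fst_lt H r (by omega)).le
  refine ⟨hk, hx, ⟨1, by rw [hc.iterate_eq H]; simp⟩, ?_⟩
  rintro q hq0 hqk ⟨m, hm⟩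
  have hP := H.perimeter_pos
  -- Positions increase strictly and advance by one perimeter in total, so an earlier return would
  -- be a shift by `m` perimeters with `0 < m < 1`.
  have h1 : x.1 < ((billiardMap ρ α h)^[q] x).1 :=
    (hc.iterate_fst_lt H 0 hk).trans_le (hmono 1 q hq0 hqk.le)
  have h2 : ((billiardMap ρ α h)^[q] x).1 < x.1 + perimeter ρ α h := by
    have := (hc.iterate_fst_lt H q hqk).trans_le (hmono (q + 1) k hqk le_rfl)
    rwa [hc.iterate_eq H] at this
  rw [hm] at h1 h2
  simp only at h1 h2
  have h3 : (0 : ℝ) < m := by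
    by_contra hc
    nlinarith [not_lt.1 hc]
  have h4 : (m : ℝ) < 1 := by
    by_contra hc
    nlinarith [not_lt.1 hc]
  have h5 : 0 < m := by exact_mod_cast h3
  have h6 : m < 1 := by exact_mod_cast h4
  omega

/-! ### Flights along the circular arc -/

/-- Parameter of the point of the circular arc at which the tangent has the angle `t`. -/
noncomputable def arcParam (ρ α : ℝ) (h : ℝ → ℝ) (t : ℝ) : ℝ := smoothLength ρ α h + ρ * (t - α)

/-- Centre of the circular arc. -/
noncomputable def arcCenter (ρ α : ℝ) (h : ℝ → ℝ) : ℝ × ℝ :=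
  ((boundary ρ α h (smoothLength ρ α h)).1 - ρ * sin α,
    (boundary ρ α h (smoothLength ρ α h)).2 + ρ * cos α)

theorem length_sub_arcParam (t : ℝ) :
    componentLength ρ α h - arcParam ρ α h t = arcParam ρ α h (π - t) := by
  unfold arcParam componentLength
  ring

theorem IsTable.le_arcParam (H : IsTable ρ α h) {t : ℝ} (h0 : α ≤ t) :
    smoothLength ρ α h ≤ arcParam ρ α h t := by
  have := mul_nonneg H.rho_pos.le (sub_nonneg.2 h0)
  unfold arcParam
  linarith

theorem IsTable.arcParam_le (H : IsTable ρ α h) {t : ℝ} (h1 : t ≤ π - α) :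
    arcParam ρ α h t ≤ componentLength ρ α h - smoothLength ρ α h := by
  have := H.le_arcParam (t := π - t) (by linarith)
  rw [← length_sub_arcParam] at this
  linarith

theorem IsTable.tangentAngle_arcParam (H : IsTable ρ α h) {t : ℝ} (h0 : α ≤ t) (h1 : t ≤ π - α) :
    tangentAngle ρ α h (arcParam ρ α h t) = t := by
  rw [H.tangentAngle_arc (H.le_arcParam h0) (H.arcParam_le h1), arcParam, add_sub_cancel_left,
    mul_div_cancel_left₀ _ H.rho_pos.ne']
  ring

theorem IsTable.curvature_arcParam (H : IsTable ρ α h) {t : ℝ} (h0 : α ≤ t) (h1 : t ≤ π - α) :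
    curvature ρ α h (arcParam ρ α h t) = 1 / ρ :=
  H.curvature_of_mem_arc (H.le_arcParam h0) (H.arcParam_le h1)

theorem IsTable.boundary_arcParam (H : IsTable ρ α h) {t : ℝ} (h0 : α ≤ t) (h1 : t ≤ π - α) :
    boundary ρ α h (arcParam ρ α h t) =
      ((arcCenter ρ α h).1 + ρ * sin t, (arcCenter ρ α h).2 - ρ * cos t) := by
  have hρ := H.rho_pos.ne'
  have hρ1 : ρ * (1 / ρ) = 1 := mul_one_div_cancel hρ
  have hc : Continuous fun σ => cos (tangentAngle ρ α h σ) :=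
    continuous_cos.comp H.continuous_tangentAngle
  have hs : Continuous fun σ => sin (tangentAngle ρ α h σ) :=
    continuous_sin.comp H.continuous_tangentAngle
  have hle := H.le_arcParam h0
  have hθ : ∀ σ ∈ uIcc (smoothLength ρ α h) (arcParam ρ α h t),
      tangentAngle ρ α h σ = α + (σ - smoothLength ρ α h) / ρ := by
    intro σ hσ
    rw [uIcc_of_le hle] at hσ
    exact H.tangentAngle_arc hσ.1 (hσ.2.trans (H.arcParam_le h1))
  have hlin : ∀ σ, HasDerivAt (fun σ => α + (σ - smoothLength ρ α h) / ρ) (1 / ρ) σ := fun σ =>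
    (((hasDerivAt_id σ).sub_const _).div_const ρ).const_add α
  have ht : α + (arcParam ρ α h t - smoothLength ρ α h) / ρ = t := by
    unfold arcParam
    field_simp
    ring
  have e1 : ∫ σ in (smoothLength ρ α h)..(arcParam ρ α h t), cos (tangentAngle ρ α h σ) =
      ρ * sin t - ρ * sin α := by
    rw [integral_eq_sub_of_hasDerivAt
      (f := fun σ => ρ * sin (α + (σ - smoothLength ρ α h) / ρ)) _ (hc.intervalIntegrable _ _)]
    · simp [ht]
    · intro σ hσ
      rw [hθ σ hσ]
      exact (((hlin σ).sin).const_mul ρ).congr_deriv (by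
        linear_combination cos (α + (σ - smoothLength ρ α h) / ρ) * hρ1)
  have e2 : ∫ σ in (smoothLength ρ α h)..(arcParam ρ α h t), sin (tangentAngle ρ α h σ) =
      -(ρ * cos t) - -(ρ * cos α) := by
    rw [integral_eq_sub_of_hasDerivAt
      (f := fun σ => -(ρ * cos (α + (σ - smoothLength ρ α h) / ρ))) _ (hs.intervalIntegrable _ _)]
    · simp [ht]
    · intro σ hσ
      rw [hθ σ hσ]
      exact (((hlin σ).cos).const_mul ρ).neg.congr_deriv (by
        linear_combination sin (α + (σ - smoothLength ρ α h) / ρ) * hρ1)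
  have a1 := integral_add_adjacent_intervals
    (hc.intervalIntegrable (μ := volume) 0 (smoothLength ρ α h))
    (hc.intervalIntegrable _ (arcParam ρ α h t))
  have a2 := integral_add_adjacent_intervals
    (hs.intervalIntegrable (μ := volume) 0 (smoothLength ρ α h))
    (hs.intervalIntegrable _ (arcParam ρ α h t))
  rw [e1] at a1
  rw [e2] at a2
  ext
  · simp only [boundary, arcCenter]; linarith
  · simp only [boundary, arcCenter]; linarith

theorem IsTable.arc_flight (H : IsTable ρ α h) {t δ : ℝ} (h0 : α ≤ t) (hδ : 0 < δ)
    (hδ' : δ < π / 2) (h1 : t + 2 * δ ≤ π - α) :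
    IsFlight ρ α h (2 * ρ * sin δ) (arcParam ρ α h t, π / 2 - δ)
      (arcParam ρ α h (t + 2 * δ), π / 2 - δ) := by
  have hρ := H.rho_pos
  have e1 : outAngle ρ α h (arcParam ρ α h t, π / 2 - δ) = t + δ := by
    simp only [outAngle, H.tangentAngle_arcParam h0 (by linarith : t ≤ π - α)]; ring
  have e2 : inAngle ρ α h (arcParam ρ α h (t + 2 * δ), π / 2 - δ) = t + δ := by
    simp only [inAngle, H.tangentAngle_arcParam (by linarith : α ≤ t + 2 * δ) h1]; ring
  have hs : 0 < sin δ := sin_pos_of_pos_of_lt_pi hδ (by linarith [pi_pos])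
  have ha : |π / 2 - δ| < π / 2 := abs_lt.2 ⟨by linarith, by linarith⟩
  have e3 : sin (t + 2 * δ) = sin (t + δ) * cos δ + cos (t + δ) * sin δ := by
    rw [← sin_add]; ring_nf
  have e4 : cos (t + 2 * δ) = cos (t + δ) * cos δ - sin (t + δ) * sin δ := by
    rw [← cos_add]; ring_nf
  have e5 : sin t = sin (t + δ) * cos δ - cos (t + δ) * sin δ := by
    rw [← sin_sub]; ring_nf
  have e6 : cos t = cos (t + δ) * cos δ + sin (t + δ) * sin δ := by
    rw [← cos_sub]; ring_nf
  refine ⟨ha, ha, ?_, ?_, by positivity, ?_, ?_, by rw [e1, e2], by rw [e1, e2]⟩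
  · simp only [arcParam]
    have : 0 < ρ * (2 * δ) := by positivity
    linarith
  · have := H.le_arcParam h0
    have := H.arcParam_le h1
    have := H.smoothLength_pos
    have := H.componentLength_pos
    simp only [perimeter]
    linarith
  · rw [e1, H.boundary_arcParam h0 (by linarith), H.boundary_arcParam (by linarith) h1]
    simp only [e3]; rw [e5]; ring
  · rw [e1, H.boundary_arcParam h0 (by linarith), H.boundary_arcParam (by linarith) h1]
    simp only [e4]; rw [e6]; ring

/-- On a circle the angle of reflection is preserved and each flight advances `s` by `ρ (π - 2 φ)`.
The derivative is therefore a shear, and shears add up. -/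
theorem IsTable.arc_chain (H : IsTable ρ α h) {t δ : ℝ} (h0 : α ≤ t) (hδ : 0 < δ)
    (hδ' : δ < π / 2) (m : ℕ) (h1 : t + 2 * m * δ ≤ π - α) :
    FlightChain ρ α h m (arcParam ρ α h t, π / 2 - δ)
      (arcParam ρ α h (t + 2 * m * δ), π / 2 - δ) (planeMap 1 (-2 * ρ * m) 0 1) := by
  induction m with
  | zero =>
    have : planeMap 1 (-2 * ρ * (0 : ℕ)) 0 1 = ContinuousLinearMap.id ℝ (ℝ × ℝ) := by
      ext <;> simp
    rw [this]
    simpa using FlightChain.refl (ρ := ρ) (α := α) (h := h) (arcParam ρ α h t, π / 2 - δ)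
  | succ m ih =>
    push_cast at h1 ⊢
    have h2 : t + 2 * m * δ + 2 * δ ≤ π - α := by linarith
    have h3 : α ≤ t + 2 * m * δ := by
      have : 0 ≤ 2 * m * δ := by positivity
      linarith
    have hs : sin δ ≠ 0 := (sin_pos_of_pos_of_lt_pi hδ (by linarith [pi_pos])).ne'
    have hρ := H.rho_pos.ne'
    have key := (ih (by linarith)).step (H.arc_flight h3 hδ hδ' h2)
    simp only [H.curvature_arcParam h3 (by linarith : t + 2 * m * δ ≤ π - α),
      H.curvature_arcParam (by linarith : α ≤ t + 2 * m * δ + 2 * δ) h2, cos_pi_div_two_sub] at key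
    rw [stepDeriv, planeMap_comp] at key
    convert key using 1
    · ring_nf
    · congr 1 <;> field_simp <;> ring

/-- The flight from a boundary point onto the circular arc. -/
theorem IsTable.entry_flight (H : IsTable ρ α h) {s φ δ ψ : ℝ}
    (hs : s ∈ Icc (-smoothLength ρ α h) (smoothLength ρ α h)) (hφ : |φ| < π / 2)
    (hδ : 0 < δ) (hδ' : δ < π / 2) (h0 : α < ψ + δ) (h1 : ψ + δ ≤ π - α)
    (hψ : tangentAngle ρ α h s + π / 2 - φ = ψ)
    (heq : ((arcCenter ρ α h).2 - (boundary ρ α h s).2) * cos ψ -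
      ((arcCenter ρ α h).1 - (boundary ρ α h s).1) * sin ψ = ρ * cos δ)
    (hpos : 0 < ((arcCenter ρ α h).1 - (boundary ρ α h s).1) * cos ψ +
      ((arcCenter ρ α h).2 - (boundary ρ α h s).2) * sin ψ + ρ * sin δ) :
    IsFlight ρ α h (((arcCenter ρ α h).1 - (boundary ρ α h s).1) * cos ψ +
      ((arcCenter ρ α h).2 - (boundary ρ α h s).2) * sin ψ + ρ * sin δ)
      (s, φ) (arcParam ρ α h (ψ + δ), π / 2 - δ) := by
  have e1 : outAngle ρ α h (s, φ) = ψ := hψ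
  have e2 : inAngle ρ α h (arcParam ρ α h (ψ + δ), π / 2 - δ) = ψ := by
    simp only [inAngle, H.tangentAngle_arcParam h0.le h1]; ring
  have ha : |π / 2 - δ| < π / 2 := abs_lt.2 ⟨by linarith, by linarith⟩
  have e5 := sin_sq_add_cos_sq ψ
  refine ⟨hφ, ha, ?_, ?_, hpos, ?_, ?_, by rw [e1, e2], by rw [e1, e2]⟩
  · have : 0 < ρ * (ψ + δ - α) := mul_pos H.rho_pos (by linarith)
    have := hs.2
    simp only [arcParam]
    linarith
  · have := H.arcParam_le h1
    have := H.componentLength_pos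
    have := H.smoothLength_pos
    have := H.two_smoothLength_lt
    have := hs.1
    simp only [perimeter]
    linarith
  · rw [e1, H.boundary_arcParam h0.le h1]
    simp only [sin_add]
    linear_combination (-((arcCenter ρ α h).1 - (boundary ρ α h s).1)) * e5 - sin ψ * heq
  · rw [e1, H.boundary_arcParam h0.le h1]
    simp only [cos_add]
    linear_combination (-((arcCenter ρ α h).2 - (boundary ρ α h s).2)) * e5 + cos ψ * heq

/-- Product of the derivatives of the flights from a smoothened segment to the circular arc, along
the arc, and to the symmetric point of the other smoothened segment. Here `k` is the curvature and
`c` the cosine of the angle of reflection at both ends, `d` is the cosine of the angles of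
reflection on the arc, and `τ` is the length of the first and of the last flight. -/
noncomputable def chainDeriv (n : ℕ) (ρ k c d τ : ℝ) : ℝ × ℝ →L[ℝ] ℝ × ℝ :=
  (stepDeriv (1 / ρ) k d c τ).comp
    ((planeMap 1 (-2 * ρ * (2 * n)) 0 1).comp (stepDeriv k (1 / ρ) c d τ))

theorem IsTable.curvature_length_sub (H : IsTable ρ α h) (s : ℝ) :
    curvature ρ α h (componentLength ρ α h - s) = curvature ρ α h s := by
  rw [sub_eq_neg_add, H.curvature_add_length, H.curvature_neg]

/-- The chain of flights from a point of a smoothened segment along the circular arc to the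
symmetric point of the other smoothened segment. -/
theorem IsTable.half_chain (H : IsTable ρ α h) (n : ℕ) {s φ δ : ℝ}
    (hs : s ∈ Icc (-smoothLength ρ α h) (smoothLength ρ α h)) (hφ : |φ| < π / 2)
    (hδ : 0 < δ) (hδ' : δ < π / 2) (h0 : α < π / 2 - 2 * n * δ)
    (hψ : φ = tangentAngle ρ α h s + (2 * n + 1) * δ)
    (heq : ((arcCenter ρ α h).2 - (boundary ρ α h s).2) * sin ((2 * n + 1) * δ) -
      ((arcCenter ρ α h).1 - (boundary ρ α h s).1) * cos ((2 * n + 1) * δ) = ρ * cos δ)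
    (hpos : 0 < ((arcCenter ρ α h).1 - (boundary ρ α h s).1) * sin ((2 * n + 1) * δ) +
      ((arcCenter ρ α h).2 - (boundary ρ α h s).2) * cos ((2 * n + 1) * δ) + ρ * sin δ) :
    FlightChain ρ α h (2 * n + 2) (s, φ) (componentLength ρ α h - s, φ)
      (chainDeriv n ρ (curvature ρ α h s) (cos φ) (sin δ)
        (((arcCenter ρ α h).1 - (boundary ρ α h s).1) * sin ((2 * n + 1) * δ) +
        ((arcCenter ρ α h).2 - (boundary ρ α h s).2) * cos ((2 * n + 1) * δ) + ρ * sin δ)) := by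
  have e1 : π / 2 - (2 * n + 1) * δ + δ = π / 2 - 2 * n * δ := by ring
  have hnδ : 0 ≤ 2 * n * δ := by positivity
  -- With this direction the tangent angles at the `2n+1` reflections on the arc run from `π/2 -
  -- 2nδ` to `π/2 + 2nδ`, symmetrically about the midpoint.
  have hent := H.entry_flight (ψ := π / 2 - (2 * n + 1) * δ) hs hφ hδ hδ' (by rw [e1]; exact h0)
    (by linarith [H.alpha_lt]) (by rw [hψ]; ring)
    (by rw [cos_pi_div_two_sub, sin_pi_div_two_sub]; exact heq)
    (by rw [cos_pi_div_two_sub, sin_pi_div_two_sub]; exact hpos)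
  rw [cos_pi_div_two_sub, sin_pi_div_two_sub, e1] at hent
  -- The last flight is the mirror image of the first, run backwards.
  have hlast := hent.reflect H
  rw [length_sub_arcParam, show π - (π / 2 - 2 * n * δ) = π / 2 + 2 * n * δ by ring] at hlast
  have harc := H.arc_chain h0.le hδ hδ' (2 * n) (by push_cast; linarith)
  rw [show π / 2 - 2 * n * δ + 2 * ((2 * n : ℕ) : ℝ) * δ = π / 2 + 2 * n * δ by
    push_cast; ring] at harc
  have key := (hent.chain.trans harc).trans hlast.chain
  simp only [H.curvature_arcParam h0.le (by linarith : π / 2 - 2 * n * δ ≤ π - α),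
    H.curvature_arcParam (by linarith : α ≤ π / 2 + 2 * n * δ) (by linarith),
    H.curvature_length_sub, cos_pi_div_two_sub] at key
  convert key using 1
  · ring
  · simp [chainDeriv]

end Chains

/-! ### Solving the equations of the symmetric orbit for small `α`. -/

section Roots

theorem abs_sin_sub_self_le {x : ℝ} (hx : |x| ≤ 1) : |sin x - x| ≤ x ^ 2 := by
  have h1 := sin_bound hx
  have h2 : |x| ^ 3 ≤ |x| ^ 2 := pow_le_pow_of_le_one (abs_nonneg x) hx (by norm_num)
  have h3 : |x| ^ 5 ≤ |x| ^ 2 := pow_le_pow_of_le_one (abs_nonneg x) hx (by norm_num)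
  have h4 : |x ^ 3| = |x| ^ 3 := abs_pow x 3
  have h5 := abs_le.1 h1
  have h6 := abs_le.1 h4.le
  rw [sq_abs] at h2 h3
  rw [abs_le]
  constructor <;> nlinarith [sq_nonneg x]

theorem abs_cos_sub_one_le (x : ℝ) : |cos x - 1| ≤ x ^ 2 / 2 := by
  rw [abs_le]
  constructor
  · linarith [one_sub_sq_div_two_le_cos (x := x)]
  · nlinarith [cos_le_one x, sq_nonneg x]

/-- For the line which is reached from a point of the smoothened segment with coordinates `b`, `-A`
relative to the centre of the unit circle and which makes an angle `π / 2 - k (δ₀ + x)` with the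
axis, the deviation of its distance from the centre from `cos (δ₀ + x)`. -/
noncomputable def chordDefect (k δ₀ A b x : ℝ) : ℝ :=
  cos (δ₀ + x) - A * sin (k * (δ₀ + x)) - b * cos (k * (δ₀ + x))

variable {k δ₀ : ℝ}

/-- The derivative is at most `-sin δ₀ / 4`: the first term contributes at most `-sin δ₀ / 2`, the
`A` term is nonpositive as `cos (k (δ₀ + z)) > 0`, and the `b` term is at most `sin δ₀ / 4`. -/
theorem chordDefect_sub_le (hk : 1 ≤ k) (hs : 0 < sin δ₀) (hcs : cos (k * δ₀) = sin δ₀)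
    {A b : ℝ} (hA : 0 ≤ A) (hb : |b| ≤ sin δ₀ / (4 * k)) {x y : ℝ}
    (hx : -(sin δ₀ / (2 * k)) ≤ x) (hxy : x ≤ y) (hy : y ≤ sin δ₀ / (2 * k)) :
    sin δ₀ / 4 * (y - x) ≤ chordDefect k δ₀ A b x - chordDefect k δ₀ A b y := by
  have hk0 : 0 < k := by linarith
  have hlin : ∀ z, HasDerivAt (fun z => δ₀ + z) 1 z := fun z => (hasDerivAt_id z).const_add δ₀
  have hlin' : ∀ z, HasDerivAt (fun z => k * (δ₀ + z)) (k * 1) z := fun z => (hlin z).const_mul k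
  have hd : ∀ z, HasDerivAt (chordDefect k δ₀ A b)
      (-sin (δ₀ + z) * 1 - A * (cos (k * (δ₀ + z)) * (k * 1)) -
        b * (-sin (k * (δ₀ + z)) * (k * 1))) z := fun z =>
    ((hlin z).cos.sub ((hlin' z).sin.const_mul A)).sub ((hlin' z).cos.const_mul b)
  have key := (convex_Icc (-(sin δ₀ / (2 * k))) (sin δ₀ / (2 * k))).image_sub_le_mul_sub_of_deriv_le
    (f := chordDefect k δ₀ A b) (C := -(sin δ₀ / 4))
    (fun z _ => (hd z).continuousAt.continuousWithinAt)
    (fun z _ => (hd z).differentiableAt.differentiableWithinAt)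
    (by
      intro z hz
      rw [interior_Icc] at hz
      rw [(hd z).deriv]
      have hz' : |z| ≤ sin δ₀ / (2 * k) := abs_le.2 ⟨hz.1.le, hz.2.le⟩
      have h1 : |sin (δ₀ + z) - sin δ₀| ≤ sin δ₀ / 2 := by
        have h2 := abs_sin_sub_sin_le (δ₀ + z) δ₀
        rw [add_sub_cancel_left] at h2
        have h3 : sin δ₀ / (2 * k) ≤ sin δ₀ / 2 := by gcongr; linarith
        linarith
      have h2 : |cos (k * (δ₀ + z)) - sin δ₀| ≤ sin δ₀ / 2 := by
        have h2 := abs_cos_sub_cos_le (k * (δ₀ + z)) (k * δ₀)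
        rw [hcs, show k * (δ₀ + z) - k * δ₀ = k * z by ring, abs_mul, abs_of_pos hk0] at h2
        have h3 : k * |z| ≤ k * (sin δ₀ / (2 * k)) := by gcongr
        have h4 : k * (sin δ₀ / (2 * k)) = sin δ₀ / 2 := by field_simp
        linarith
      have h3 : |b * sin (k * (δ₀ + z)) * k| ≤ sin δ₀ / 4 := by
        rw [abs_mul, abs_mul, abs_of_pos hk0]
        have h4 : |b| * |sin (k * (δ₀ + z))| * k ≤ sin δ₀ / (4 * k) * 1 * k := by
          gcongr; exact abs_sin_le_one _
        have h5 : sin δ₀ / (4 * k) * 1 * k = sin δ₀ / 4 := by field_simp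
        linarith
      have h4 := (abs_le.1 h1).1
      have h5 := (abs_le.1 h2).1
      have h6 := (abs_le.1 h3).2
      have h7 : 0 ≤ A * (cos (k * (δ₀ + z)) * k) :=
        mul_nonneg hA (mul_nonneg (by linarith) hk0.le)
      linarith)
    x ⟨hx, hxy.trans hy⟩ y ⟨hx.trans hxy, hy⟩ hxy
  linarith

/-- At the root of the linearized equation only a quadratic error is left. -/
theorem abs_chordDefect_le (hk : 1 ≤ k) (hcs : cos (k * δ₀) = sin δ₀)
    (hsc : sin (k * δ₀) = cos δ₀) {α A b β : ℝ} (hα : 0 ≤ α) (hα1 : α ≤ 1 / 5)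
    (hβ : |β| ≤ 5) (hA : |A - 1| ≤ 5 * α ^ 2) (hb : |b - α * β| ≤ 3 * α ^ 2) :
    |chordDefect k δ₀ A b (-(α * β / (k + 1)))| ≤ 200 * α ^ 2 := by
  set x := -(α * β / (k + 1)) with hx
  set y := k * x with hy
  have hk1 : k + 1 ≠ 0 := by linarith
  have hxy : x + y = -(α * β) := by rw [hy, hx]; field_simp; ring
  have hαβ : |α * β| ≤ 5 * α := by
    rw [abs_mul, abs_of_nonneg hα]; nlinarith
  have hx5 : |x| ≤ 5 * α := by
    rw [hx, abs_neg, abs_div, abs_of_pos (by linarith : 0 < k + 1)]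
    exact (div_le_self (abs_nonneg _) (by linarith)).trans hαβ
  have hy5 : |y| ≤ 5 * α := by
    have : y = -(α * β * (k / (k + 1))) := by rw [hy, hx]; field_simp
    rw [this, abs_neg, abs_mul, abs_of_nonneg (by positivity : 0 ≤ k / (k + 1))]
    exact (mul_le_of_le_one_right (abs_nonneg _)
      ((div_le_one (by linarith)).2 (by linarith))).trans hαβ
  have hx2 : x ^ 2 ≤ 25 * α ^ 2 := by
    rw [← sq_abs]; nlinarith [abs_nonneg x]
  have hy2 : y ^ 2 ≤ 25 * α ^ 2 := by
    rw [← sq_abs]; nlinarith [abs_nonneg y]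
  have hb8 : |b| ≤ 8 * α := by
    have h1 : |b| ≤ |b - α * β| + |α * β| := by
      simpa using abs_add_le (b - α * β) (α * β)
    nlinarith
  have hsx := abs_sin_sub_self_le (x := x) (by linarith)
  have hsy := abs_sin_sub_self_le (x := y) (by linarith)
  have hcx := abs_cos_sub_one_le x
  have hcy := abs_cos_sub_one_le y
  -- The first-order part is `-sin δ₀ (x + k x + α β)`, which vanishes by the choice of `x`. Every
  -- remaining term is `O(α²)`.
  have e : chordDefect k δ₀ A b x = cos δ₀ * ((cos x - 1) - (cos y - 1)) -
      sin δ₀ * ((sin x - x) + (sin y - y)) - sin δ₀ * (b - α * β) -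
      (A - 1) * sin (k * (δ₀ + x)) -
      b * (sin δ₀ * (cos y - 1) - cos δ₀ * sin y) := by
    have e1 : k * (δ₀ + x) = k * δ₀ + y := by rw [hy]; ring
    unfold chordDefect
    rw [e1, cos_add, cos_add, sin_add, hcs, hsc]
    linear_combination (-sin δ₀) * hxy
  have t1 : |cos δ₀ * ((cos x - 1) - (cos y - 1))| ≤ 25 * α ^ 2 := by
    rw [abs_mul]
    have := abs_sub (cos x - 1) (cos y - 1)
    calc _ ≤ 1 * (|cos x - 1| + |cos y - 1|) := by
          gcongr
          · exact abs_cos_le_one _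
      _ ≤ 25 * α ^ 2 := by linarith
  have t2 : |sin δ₀ * ((sin x - x) + (sin y - y))| ≤ 50 * α ^ 2 := by
    rw [abs_mul]
    have := abs_add_le (sin x - x) (sin y - y)
    calc _ ≤ 1 * (|sin x - x| + |sin y - y|) := by
          gcongr
          · exact abs_sin_le_one _
      _ ≤ 50 * α ^ 2 := by linarith
  have t3 : |sin δ₀ * (b - α * β)| ≤ 3 * α ^ 2 := by
    rw [abs_mul]
    exact (mul_le_of_le_one_left (abs_nonneg _) (abs_sin_le_one _)).trans hb
  have t4 : |(A - 1) * sin (k * (δ₀ + x))| ≤ 5 * α ^ 2 := by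
    rw [abs_mul]
    exact (mul_le_of_le_one_right (abs_nonneg _) (abs_sin_le_one _)).trans hA
  have t5 : |b * (sin δ₀ * (cos y - 1) - cos δ₀ * sin y)| ≤ 80 * α ^ 2 := by
    have s1 : |sin δ₀ * (cos y - 1) - cos δ₀ * sin y| ≤ 10 * α := by
      have a1 : |sin δ₀ * (cos y - 1)| ≤ |cos y - 1| := by
        rw [abs_mul]; exact mul_le_of_le_one_left (abs_nonneg _) (abs_sin_le_one _)
      have a2 : |cos δ₀ * sin y| ≤ |sin y| := by
        rw [abs_mul]; exact mul_le_of_le_one_left (abs_nonneg _) (abs_cos_le_one _)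
      have a3 : |sin y| ≤ |y| := abs_sin_le_abs
      have a4 := abs_sub (sin δ₀ * (cos y - 1)) (cos δ₀ * sin y)
      nlinarith
    rw [abs_mul]
    calc |b| * |sin δ₀ * (cos y - 1) - cos δ₀ * sin y| ≤ 8 * α * (10 * α) := by gcongr
      _ = 80 * α ^ 2 := by ring
  rw [e]
  -- The five bounds add up to `(25 + 50 + 3 + 5 + 80) α² = 163 α²`.
  rw [abs_le] at t1 t2 t3 t4 t5 ⊢
  constructor <;> linarith [t1.1, t1.2, t2.1, t2.2, t3.1, t3.2, t4.1, t4.2, t5.1, t5.2,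
    sq_nonneg α]

/-- A defect of at most `200 α²` at the approximate root and a slope of at least `sin δ₀ / 4` in
size force a zero within `800 α² / sin δ₀`. -/
theorem exists_chordDefect_eq_zero (hk : 1 ≤ k) (hs : 0 < sin δ₀) (hcs : cos (k * δ₀) = sin δ₀)
    (hsc : sin (k * δ₀) = cos δ₀) {α A b β : ℝ} (hα : 0 < α)
    (hα1 : α ≤ sin δ₀ ^ 2 / (3200 * k))
    (hβ : |β| ≤ 5) (hA : |A - 1| ≤ 5 * α ^ 2) (hb : |b - α * β| ≤ 3 * α ^ 2) :
    ∃ x, chordDefect k δ₀ A b x = 0 ∧ |x| ≤ 6 * α ∧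
      |x + α * β / (k + 1)| ≤ 800 / sin δ₀ * α ^ 2 ∧ |x| ≤ sin δ₀ / (2 * k) ∧
      0 ≤ A ∧ |b| ≤ sin δ₀ / (4 * k) := by
  have hk0 : 0 < k := by linarith
  have hs1 := sin_le_one δ₀
  set σ := sin δ₀ with hσ
  have hαk : α * (3200 * k) ≤ σ ^ 2 := (le_div_iff₀ (by positivity)).1 hα1
  have hσ2 : σ ^ 2 ≤ σ := by nlinarith
  have hα3 : α ≤ 1 / 3200 := by nlinarith
  have hαβ : |α * β| ≤ 5 * α := by
    rw [abs_mul, abs_of_pos hα]; nlinarith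
  have hb8 : |b| ≤ 8 * α := by
    have h1 : |b| ≤ |b - α * β| + |α * β| := by
      simpa using abs_add_le (b - α * β) (α * β)
    nlinarith
  have hb' : |b| ≤ σ / (4 * k) := by
    rw [le_div_iff₀ (by positivity)]
    have : |b| * (4 * k) ≤ 8 * α * (4 * k) := by gcongr
    nlinarith
  have hA' : 0 ≤ A := by
    have := (abs_le.1 hA).1
    nlinarith
  have hx5 : |α * β / (k + 1)| ≤ 5 * α := by
    rw [abs_div, abs_of_pos (by linarith : 0 < k + 1)]
    exact (div_le_self (abs_nonneg _) (by linarith)).trans hαβ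
  have hw : 800 / σ * α ^ 2 ≤ α := by
    have h1 : 800 * α ≤ σ := by nlinarith
    have h2 : 800 / σ * α ^ 2 = (800 * α) / σ * α := by field_simp
    rw [h2]
    exact mul_le_of_le_one_left hα.le ((div_le_one hs).2 h1)
  have hw0 : 0 ≤ 800 / σ * α ^ 2 := by positivity
  have h6 : 6 * α ≤ σ / (2 * k) := by
    rw [le_div_iff₀ (by positivity)]
    nlinarith
  set x₀ := -(α * β / (k + 1)) with hx₀
  set w := 800 / σ * α ^ 2 with hw'
  have hx₀' : |x₀| ≤ 5 * α := by rw [hx₀, abs_neg]; exact hx5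
  have hx₀1 := (abs_le.1 hx₀').1
  have hx₀2 := (abs_le.1 hx₀').2
  have hd := abs_le.1 (abs_chordDefect_le hk hcs hsc hα.le (by linarith) hβ hA hb)
  rw [← hx₀] at hd
  have hsw : σ / 4 * w = 200 * α ^ 2 := by rw [hw']; field_simp; ring
  have hl := chordDefect_sub_le hk hs hcs hA' hb' (x := x₀ - w) (y := x₀) (by linarith)
    (by linarith) (by linarith)
  have hr := chordDefect_sub_le hk hs hcs hA' hb' (x := x₀) (y := x₀ + w) (by linarith)
    (by linarith) (by linarith)
  rw [← hσ, sub_sub_cancel, hsw] at hl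
  rw [← hσ, add_sub_cancel_left, hsw] at hr
  have hcont : Continuous (chordDefect k δ₀ A b) := by unfold chordDefect; fun_prop
  have hle : x₀ - w ≤ x₀ + w := by linarith
  obtain ⟨x, hx, hx0⟩ := intermediate_value_Icc' hle hcont.continuousOn
    (show (0 : ℝ) ∈ Icc _ _ from ⟨by linarith [hd.2], by linarith [hd.1]⟩)
  have hx6 : |x| ≤ 6 * α := abs_le.2 ⟨by linarith [hx.1], by linarith [hx.2]⟩
  refine ⟨x, hx0, hx6, ?_, hx6.trans h6, hA', hb'⟩
  have : x + α * β / (k + 1) = x - x₀ := by rw [hx₀]; ring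
  rw [this]
  exact abs_le.2 ⟨by linarith [hx.1], by linarith [hx.2]⟩

/-- By the slope bound the root is a Lipschitz function of `(A, b)`. This makes the angle correction
continuous in `u`, as the intermediate value theorem needs. -/
theorem abs_root_sub_le (hk : 1 ≤ k) (hs : 0 < sin δ₀) (hcs : cos (k * δ₀) = sin δ₀)
    {A b A' b' x x' : ℝ} (hA : 0 ≤ A) (hb : |b| ≤ sin δ₀ / (4 * k))
    (hx : |x| ≤ sin δ₀ / (2 * k)) (hx' : |x'| ≤ sin δ₀ / (2 * k))
    (h0 : chordDefect k δ₀ A b x = 0) (h0' : chordDefect k δ₀ A' b' x' = 0) :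
    |x - x'| ≤ 4 / sin δ₀ * (|A - A'| + |b - b'|) := by
  have key : sin δ₀ / 4 * |x - x'| ≤ |chordDefect k δ₀ A b x'| := by
    rw [abs_le] at hx hx'
    rcases le_total x x' with h1 | h1
    · have := chordDefect_sub_le hk hs hcs hA hb hx.1 h1 hx'.2
      rw [h0] at this
      rw [abs_sub_comm, abs_of_nonneg (sub_nonneg.2 h1)]
      exact this.trans ((le_abs_self _).trans (by rw [zero_sub, abs_neg]))
    · have := chordDefect_sub_le hk hs hcs hA hb hx'.1 h1 hx.2
      rw [h0, sub_zero] at this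
      rw [abs_of_nonneg (sub_nonneg.2 h1)]
      exact this.trans (le_abs_self _)
  have h2 : chordDefect k δ₀ A b x' =
      -((A - A') * sin (k * (δ₀ + x'))) - (b - b') * cos (k * (δ₀ + x')) := by
    rw [← sub_zero (chordDefect k δ₀ A b x'), ← h0']
    unfold chordDefect
    ring
  have h3 : |chordDefect k δ₀ A b x'| ≤ |A - A'| + |b - b'| := by
    rw [h2]
    refine (abs_sub _ _).trans ?_
    rw [abs_neg, abs_mul, abs_mul]
    exact add_le_add (mul_le_of_le_one_right (abs_nonneg _) (abs_sin_le_one _))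
      (mul_le_of_le_one_right (abs_nonneg _) (abs_cos_le_one _))
  have h4 : |x - x'| = 4 / sin δ₀ * (sin δ₀ / 4 * |x - x'|) := by field_simp
  rw [h4]
  gcongr
  exact key.trans h3

/-- The equations which determine the symmetric periodic orbit have a solution near the solution of
their linearization. -/
theorem exists_symmetric_solution (hk : 1 ≤ k) (hs : 0 < sin δ₀) (hcs : cos (k * δ₀) = sin δ₀)
    (hsc : sin (k * δ₀) = cos δ₀) {I u₁ u₂ : ℝ} (hI : 1 / 2 < I) (hu₁ : 0 ≤ u₁) (hu : u₁ ≤ u₂)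
    (hu₂ : u₂ ≤ 1) {T : ℝ → ℝ} (hT : ContinuousOn T (Icc 0 1))
    (h₁ : T u₁ < k / (k + 1) * (u₁ / I)) (h₂ : k / (k + 1) * (u₂ / I) < T u₂) :
    ∃ α₁ > 0, ∀ α, 0 < α → α < α₁ → ∀ A b : ℝ → ℝ, Continuous A → Continuous b →
      (∀ u ∈ Icc (-1 : ℝ) 1, |A u - 1| ≤ 5 * α ^ 2) →
      (∀ u ∈ Icc (-1 : ℝ) 1, |b u - α * ((u - 1) / I + 1)| ≤ 3 * α ^ 2) →
      ∃ u ∈ Icc u₁ u₂, ∃ x y : ℝ, |x| ≤ 6 * α ∧ |y| ≤ 6 * α ∧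
        chordDefect k δ₀ (A u) (b u) x = 0 ∧ chordDefect k δ₀ (A (-u)) (b (-u)) y = 0 ∧
        k * (y - x) = 2 * α * T u := by
  have hI0 : 0 < I := by linarith
  have hk0 : 0 < k := by linarith
  set σ := sin δ₀ with hσ
  -- Margins of the linearized equation at the endpoints; `α₁` is so small that the quadratic errors
  -- cannot exceed them.
  set μ₁ := k / (k + 1) * (u₁ / I) - T u₁ with hμ₁
  set μ₂ := T u₂ - k / (k + 1) * (u₂ / I) with hμ₂
  have hμ₁0 : 0 < μ₁ := by linarith
  have hμ₂0 : 0 < μ₂ := by linarith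
  refine ⟨min (σ ^ 2 / (3200 * k)) (min (μ₁ / (k * (800 / σ))) (μ₂ / (k * (800 / σ)))),
    lt_min (by positivity) (lt_min (by positivity) (by positivity)), ?_⟩
  intro α hα hα1 A b hAc hbc hA hb
  rw [lt_min_iff, lt_min_iff] at hα1
  obtain ⟨hα2, hα3, hα4⟩ := hα1
  rw [lt_div_iff₀ (by positivity)] at hα3 hα4
  have hβ : ∀ u ∈ Icc (-1 : ℝ) 1, |(u - 1) / I + 1| ≤ 5 := by
    intro u hu
    have h1 : (1 - u) / I ≤ 4 := by
      rw [div_le_iff₀ hI0]; linarith [hu.1]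
    have h2 : 0 ≤ (1 - u) / I := div_nonneg (by linarith [hu.2]) hI0.le
    have h3 : (u - 1) / I = -((1 - u) / I) := by ring
    rw [h3, abs_le]
    constructor <;> linarith
  choose! X hX0 hX6 hX hXr hA' hb' using fun u (hu : u ∈ Icc (-1 : ℝ) 1) =>
    exists_chordDefect_eq_zero hk hs hcs hsc hα hα2.le (hβ u hu) (hA u hu) (hb u hu)
  have hXc : ContinuousOn X (Icc (-1) 1) := by
    intro u hu
    have hlim : Tendsto (fun v => 4 / sin δ₀ * (|A v - A u| + |b v - b u|)) (𝓝[Icc (-1) 1] u)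
        (𝓝 0) := by
      have : Continuous fun v => 4 / sin δ₀ * (|A v - A u| + |b v - b u|) := by fun_prop
      have h2 := this.tendsto u
      simp only [sub_self, abs_zero, add_zero, mul_zero] at h2
      exact h2.mono_left nhdsWithin_le_nhds
    rw [ContinuousWithinAt, tendsto_iff_dist_tendsto_zero]
    refine squeeze_zero' (Eventually.of_forall fun v => dist_nonneg) ?_ hlim
    filter_upwards [self_mem_nhdsWithin] with v hv
    exact abs_root_sub_le hk hs hcs (hA' v hv) (hb' v hv) (hXr v hv) (hXr u hu) (hX0 v hv)
      (hX0 u hu)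
  have hmem : ∀ u ∈ Icc u₁ u₂, u ∈ Icc (-1 : ℝ) 1 := fun u h =>
    ⟨by linarith [h.1], by linarith [h.2]⟩
  have hmem' : ∀ u ∈ Icc u₁ u₂, -u ∈ Icc (-1 : ℝ) 1 := fun u h =>
    ⟨by linarith [h.2], by linarith [h.1]⟩
  -- Defect of the reflection law: `X u` and `X (-u)` are the angle corrections on the two arcs,
  -- seen from the same boundary point.
  let G := fun u => k * (X (-u) - X u) - 2 * α * T u
  have hG : ContinuousOn G (Icc u₁ u₂) :=
    (continuousOn_const.mul ((hXc.comp continuousOn_neg hmem').sub (hXc.mono hmem))).sub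
      (continuousOn_const.mul (hT.mono fun u h => ⟨by linarith [h.1], by linarith [h.2]⟩))
  have hest : ∀ u ∈ Icc u₁ u₂, |G u - 2 * α * (k / (k + 1) * (u / I) - T u)| ≤
      2 * α * (α * (k * (800 / σ))) := by
    intro u hu
    have e1 := abs_le.1 (hX u (hmem u hu))
    have e2 := abs_le.1 (hX (-u) (hmem' u hu))
    have e3 : G u - 2 * α * (k / (k + 1) * (u / I) - T u) =
        k * ((X (-u) + α * ((-u - 1) / I + 1) / (k + 1)) -
          (X u + α * ((u - 1) / I + 1) / (k + 1))) := by
      simp only [G]; field_simp; ring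
    rw [e3, abs_mul, abs_of_pos hk0]
    have e4 : |(X (-u) + α * ((-u - 1) / I + 1) / (k + 1)) -
          (X u + α * ((u - 1) / I + 1) / (k + 1))| ≤ 2 * (800 / σ * α ^ 2) :=
      abs_le.2 ⟨by linarith [e1.2, e2.1], by linarith [e1.1, e2.2]⟩
    calc _ ≤ k * (2 * (800 / σ * α ^ 2)) := by gcongr
      _ = _ := by ring
  have hG1 : 0 ≤ G u₁ := by
    have := (abs_le.1 (hest u₁ (left_mem_Icc.2 hu))).1
    rw [← hμ₁] at this
    nlinarith
  have hG2 : G u₂ ≤ 0 := by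
    have := (abs_le.1 (hest u₂ (right_mem_Icc.2 hu))).2
    have h3 : k / (k + 1) * (u₂ / I) - T u₂ = -μ₂ := by rw [hμ₂]; ring
    rw [h3] at this
    nlinarith
  obtain ⟨u, hu, hu0⟩ := intermediate_value_Icc' hu hG (show (0 : ℝ) ∈ Icc _ _ from ⟨hG2, hG1⟩)
  exact ⟨u, hu, X u, X (-u), hX6 u (hmem u hu), hX6 (-u) (hmem' u hu), hX0 u (hmem u hu),
    hX0 (-u) (hmem' u hu), by simp only [G] at hu0; linarith⟩

end Roots

/-! ### Trace and determinant of the derivative along the orbit. -/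

section Trace

/-- Upper left entry of `chainDeriv` for `ρ = 1`. -/
noncomputable def chainEntry₁₁ (n : ℕ) (κ c d τ : ℝ) : ℝ :=
  (τ - d) / c * ((τ * κ - c) / d - 4 * n * (κ - (τ * κ - c) / d)) -
    τ / c * (κ - (τ * κ - c) / d)

/-- Upper right entry of `chainDeriv` for `ρ = 1`. -/
noncomputable def chainEntry₁₂ (n : ℕ) (c d τ : ℝ) : ℝ :=
  (τ - d) / c * (-(τ / d) - 4 * n * (-1 + τ / d)) - τ / c * (-1 + τ / d)

/-- Lower left entry of `chainDeriv` for `ρ = 1`. -/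
noncomputable def chainEntry₂₁ (n : ℕ) (κ c d τ : ℝ) : ℝ :=
  (1 - κ * ((τ - d) / c)) * ((τ * κ - c) / d - 4 * n * (κ - (τ * κ - c) / d)) +
    (-1 + κ * τ / c) * (κ - (τ * κ - c) / d)

/-- Lower right entry of `chainDeriv` for `ρ = 1`. -/
noncomputable def chainEntry₂₂ (n : ℕ) (κ c d τ : ℝ) : ℝ :=
  (1 - κ * ((τ - d) / c)) * (-(τ / d) - 4 * n * (-1 + τ / d)) +
    (-1 + κ * τ / c) * (-1 + τ / d)

theorem chainDeriv_eq (n : ℕ) {ρ : ℝ} (hρ : ρ ≠ 0) (κ c d τ : ℝ) :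
    chainDeriv n ρ (κ / ρ) c d (ρ * τ) =
      planeMap (chainEntry₁₁ n κ c d τ) (ρ * chainEntry₁₂ n c d τ)
        (chainEntry₂₁ n κ c d τ / ρ) (chainEntry₂₂ n κ c d τ) := by
  have e1 : ρ * τ * (κ / ρ) = τ * κ := by field_simp
  have e2 : ρ * τ * (1 / ρ) = τ := by field_simp
  have e3 : 1 / ρ * (ρ * τ) = τ := by field_simp
  have e4 : κ / ρ * (ρ * τ) = κ * τ := by field_simp
  rw [chainDeriv, stepDeriv, stepDeriv, planeMap_comp, planeMap_comp, e1, e2, e3, e4]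
  unfold chainEntry₁₁ chainEntry₁₂ chainEntry₂₁ chainEntry₂₂
  congr 1
  · field_simp
    ring
  · field_simp
    ring
  · field_simp
    ring
  · field_simp
    ring

/-- In the coordinates `(s, φ)` one step has determinant `c₀ / c₁`. This telescopes to 1, since both
ends of the half chain have the same cosine. -/
theorem chainEntry_det (n : ℕ) {κ c d τ : ℝ} (hc : c ≠ 0) (hd : d ≠ 0) :
    chainEntry₁₁ n κ c d τ * chainEntry₂₂ n κ c d τ -
      chainEntry₁₂ n c d τ * chainEntry₂₁ n κ c d τ = 1 := by
  unfold chainEntry₁₁ chainEntry₁₂ chainEntry₂₁ chainEntry₂₂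
  field_simp
  ring

/-- The trace of the derivative along the orbit as a function of the curvature `κ` and the cosine
`c` of the angle of reflection on the smoothened segments, and of the cosines `d₁, d₂` of the angles
of reflection on both arcs and the lengths `τ₁, τ₂` of the flights to these arcs. -/
noncomputable def cycleTrace (n : ℕ) (κ c d₁ τ₁ d₂ τ₂ : ℝ) : ℝ :=
  chainEntry₁₁ n κ c d₂ τ₂ * chainEntry₁₁ n κ c d₁ τ₁ +
    chainEntry₁₂ n c d₂ τ₂ * chainEntry₂₁ n κ c d₁ τ₁ +
    (chainEntry₂₁ n κ c d₂ τ₂ * chainEntry₁₂ n c d₁ τ₁ +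
    chainEntry₂₂ n κ c d₂ τ₂ * chainEntry₂₂ n κ c d₁ τ₁)

theorem trace_chainDeriv_comp (n : ℕ) {ρ : ℝ} (hρ : ρ ≠ 0) (κ c d₁ τ₁ d₂ τ₂ : ℝ) :
    LinearMap.trace ℝ (ℝ × ℝ) ((chainDeriv n ρ (κ / ρ) c d₂ (ρ * τ₂)).comp
      (chainDeriv n ρ (κ / ρ) c d₁ (ρ * τ₁)) : ℝ × ℝ →ₗ[ℝ] ℝ × ℝ) =
      cycleTrace n κ c d₁ τ₁ d₂ τ₂ := by
  rw [chainDeriv_eq n hρ, chainDeriv_eq n hρ, planeMap_comp, trace_planeMap, cycleTrace]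
  field_simp

theorem det_chainDeriv_comp (n : ℕ) {ρ : ℝ} (hρ : ρ ≠ 0) (κ : ℝ) {c d₁ d₂ : ℝ} (τ₁ τ₂ : ℝ)
    (hc : c ≠ 0) (hd₁ : d₁ ≠ 0) (hd₂ : d₂ ≠ 0) :
    LinearMap.det ((chainDeriv n ρ (κ / ρ) c d₂ (ρ * τ₂)).comp
      (chainDeriv n ρ (κ / ρ) c d₁ (ρ * τ₁)) : ℝ × ℝ →ₗ[ℝ] ℝ × ℝ) = 1 := by
  have h1 := chainEntry_det n (κ := κ) (τ := τ₁) hc hd₁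
  have h2 := chainEntry_det n (κ := κ) (τ := τ₂) hc hd₂
  rw [chainDeriv_eq n hρ, chainDeriv_eq n hρ, planeMap_comp, det_planeMap]
  field_simp
  linear_combination (chainEntry₁₁ n κ c d₁ τ₁ * chainEntry₂₂ n κ c d₁ τ₁ -
      chainEntry₁₂ n c d₁ τ₁ * chainEntry₂₁ n κ c d₁ τ₁) * h2 + h1

/-- Both halves have the same matrix here, of determinant 1, so this is `tr (A²) = (tr A)² - 2`. -/
theorem cycleTrace_limit (n : ℕ) (κ : ℝ) {s : ℝ} (hs : s ≠ 0) :
    cycleTrace n κ s s (2 * s) s (2 * s) = (2 - 8 * (n + 1) * (1 - κ)) ^ 2 - 2 := by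
  unfold cycleTrace chainEntry₁₁ chainEntry₁₂ chainEntry₂₁ chainEntry₂₂
  have e1 : (2 * s * κ - s) / s = 2 * κ - 1 := by field_simp
  have e2 : 2 * s / s = 2 := by field_simp
  have e3 : (2 * s - s) / s = 1 := by field_simp; ring
  have e4 : κ * (2 * s) / s = 2 * κ := by field_simp
  rw [e1, e2, e3, e4]
  ring

theorem continuousAt_cycleTrace (n : ℕ) (κ : ℝ) {s : ℝ} (hs : s ≠ 0) :
    ContinuousAt (fun v : ℝ × ℝ × ℝ × ℝ × ℝ × ℝ =>
      cycleTrace n v.1 v.2.1 v.2.2.1 v.2.2.2.1 v.2.2.2.2.1 v.2.2.2.2.2)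
      (κ, s, s, 2 * s, s, 2 * s) := by
  unfold cycleTrace chainEntry₁₁ chainEntry₁₂ chainEntry₂₁ chainEntry₂₂
  fun_prop (disch := exact hs)

/-- The three conditions on `κ` say `-2 < w`, `w < 2` and `w ≠ 0` for the half trace `w`, whence
`|w² - 2| < 2`; this is an open condition. -/
theorem exists_abs_cycleTrace_lt (n : ℕ) {κ s : ℝ} (hs : s ≠ 0)
    (h1 : (2 * (n : ℝ) + 1) / (2 * n + 2) < κ) (h2 : κ < 1)
    (h3 : κ ≠ (2 * (n : ℝ) + 3 / 2) / (2 * n + 2)) :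
    ∃ ε > 0, ∀ κ' c d₁ τ₁ d₂ τ₂ : ℝ, |κ' - κ| < ε → |c - s| < ε → |d₁ - s| < ε →
      |τ₁ - 2 * s| < ε → |d₂ - s| < ε → |τ₂ - 2 * s| < ε →
      |cycleTrace n κ' c d₁ τ₁ d₂ τ₂| < 2 := by
  have hn : (0 : ℝ) < 2 * n + 2 := by positivity
  have hlim : |cycleTrace n κ s s (2 * s) s (2 * s)| < 2 := by
    rw [cycleTrace_limit n κ hs]
    rw [div_lt_iff₀ hn] at h1
    have h3' : κ * (2 * n + 2) ≠ 2 * n + 3 / 2 := fun h => h3 ((eq_div_iff hn.ne').2 h)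
    set w := 2 - 8 * ((n : ℝ) + 1) * (1 - κ) with hw
    have hw0 : w ≠ 0 := fun h => h3' (by linarith)
    have hw1 : -2 < w := by rw [hw]; linarith
    have hw2 : w < 2 := by
      have : 0 < ((n : ℝ) + 1) * (1 - κ) := mul_pos (by positivity) (by linarith)
      rw [hw]; linarith
    have hw3 : 0 < w ^ 2 := by positivity
    rw [abs_lt]
    constructor <;> nlinarith
  have hev := (continuousAt_cycleTrace n κ hs).abs.eventually_lt continuousAt_const hlim
  obtain ⟨ε, hε, hball⟩ := Metric.eventually_nhds_iff.1 hev
  refine ⟨ε, hε, fun κ' c d₁ τ₁ d₂ τ₂ a1 a2 a3 a4 a5 a6 => ?_⟩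
  refine @hball (κ', c, d₁, τ₁, d₂, τ₂) ?_
  simp only [Prod.dist_eq, Real.dist_eq, max_lt_iff]
  exact ⟨a1, a2, a3, a4, a5, a6⟩

end Trace

/-! ### The linearized equation for the profile `h`. -/

section Profile

variable {h : ℝ → ℝ}

theorem profile_intervalIntegrable (hc : ContinuousOn h (Icc 0 1)) {a b : ℝ} (ha : 0 ≤ a)
    (hab : a ≤ b) (hb : b ≤ 1) : IntervalIntegrable h volume a b :=
  ContinuousOn.intervalIntegrable_of_Icc hab (hc.mono (Icc_subset_Icc ha hb))

theorem profile_integral_le (hc : ContinuousOn h (Icc 0 1)) (ha : AntitoneOn h (Icc 0 1))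
    {a b : ℝ} (h0 : 0 ≤ a) (hab : a ≤ b) (hb : b ≤ 1) :
    ∫ ξ in a..b, h ξ ≤ (b - a) * h a := by
  have := integral_mono_on hab (profile_intervalIntegrable hc h0 hab hb)
    (intervalIntegrable_const (c := h a)) (fun x hx => ha ⟨h0, hab.trans hb⟩
      ⟨h0.trans hx.1, hx.2.trans hb⟩ hx.1)
  simpa using this

theorem le_profile_integral (hc : ContinuousOn h (Icc 0 1)) (ha : AntitoneOn h (Icc 0 1))
    {a b : ℝ} (h0 : 0 ≤ a) (hab : a ≤ b) (hb : b ≤ 1) :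
    (b - a) * h b ≤ ∫ ξ in a..b, h ξ := by
  have := integral_mono_on hab (intervalIntegrable_const (c := h b))
    (profile_intervalIntegrable hc h0 hab hb) (fun x hx => ha ⟨h0.trans hx.1, hx.2.trans hb⟩
      ⟨h0.trans hab, hb⟩ hx.2)
  simpa using this

theorem continuousOn_profile_integral (hc : ContinuousOn h (Icc 0 1)) :
    ContinuousOn (fun u => ∫ ξ in (1 - u)..1, h ξ) (Icc 0 1) := by
  have h1 : ContinuousOn (fun x => ∫ ξ in (1 : ℝ)..x, h ξ) (uIcc 0 1) :=
    continuousOn_primitive_interval' (profile_intervalIntegrable hc le_rfl zero_le_one le_rfl)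
      (by simp)
  rw [uIcc_of_le zero_le_one] at h1
  have h2 : ContinuousOn (fun u => -∫ ξ in (1 : ℝ)..(1 - u), h ξ) (Icc 0 1) :=
    (h1.comp (Continuous.continuousOn (by fun_prop : Continuous fun u : ℝ => 1 - u))
      (fun u hu => ⟨by linarith [hu.2], by linarith [hu.1]⟩)).neg
  exact h2.congr fun u _ => integral_symm _ _

/-- The linearized equation `∫_{1 - u}^1 h = l u` has a solution, which is isolated and at which
the profile exceeds `l`. -/
theorem exists_profile_root (hc : ContinuousOn h (Icc 0 1)) (ha : AntitoneOn h (Icc 0 1))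
    (h_one : h 1 = 0) (h_zero : h 0 = 1) {l : ℝ} (hl0 : 0 < l) (hl1 : l < 1)
    (hl : l < ∫ ξ in (0 : ℝ)..1, h ξ) :
    ∃ u ∈ Ioo (0 : ℝ) 1, ∫ ξ in (1 - u)..1, h ξ = l * u ∧ l < h (1 - u) ∧
      ∀ η > 0, ∃ u₁ u₂, 0 ≤ u₁ ∧ u₁ ≤ u₂ ∧ u₂ ≤ 1 ∧ u - η < u₁ ∧ u₂ < u + η ∧
        ∫ ξ in (1 - u₁)..1, h ξ < l * u₁ ∧ l * u₂ < ∫ ξ in (1 - u₂)..1, h ξ := by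
  have hint := fun {a b : ℝ} => profile_intervalIntegrable hc (a := a) (b := b)
  have hadd : ∀ a b : ℝ, 0 ≤ a → a ≤ b → b ≤ 1 →
      ∫ ξ in (1 - b)..1, h ξ = (∫ ξ in (1 - b)..(1 - a), h ξ) + ∫ ξ in (1 - a)..1, h ξ :=
    fun a b h0 hab hb => (integral_add_adjacent_intervals
      (hint (by linarith) (by linarith) (by linarith)) (hint (by linarith) (by linarith)
      (by linarith))).symm
  -- Beyond `z` the profile is at most `l / 2`, so the integral is below `l u` at `u = 1 - z`. At `u
  -- = 1` it is above, which brackets a root away from the trivial one `u = 0`.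
  obtain ⟨z, hz, hzl⟩ := intermediate_value_Icc' zero_le_one hc
    (show l / 2 ∈ Icc _ _ from ⟨by rw [h_one]; linarith, by rw [h_zero]; linarith⟩)
  have hz1 : z < 1 := lt_of_le_of_ne hz.2 (by rintro rfl; linarith)
  have hz0 : 0 < z := lt_of_le_of_ne hz.1 (by rintro rfl; linarith)
  have hgz : ∫ ξ in (1 - (1 - z))..1, h ξ < l * (1 - z) := by
    have := profile_integral_le hc ha (a := 1 - (1 - z)) (b := 1) (by linarith) (by linarith) le_rfl
    rw [sub_sub_cancel, hzl] at this
    rw [sub_sub_cancel]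
    nlinarith
  have hgc : ContinuousOn (fun u => (∫ ξ in (1 - u)..1, h ξ) - l * u) (Icc 0 1) :=
    (continuousOn_profile_integral hc).sub (by fun_prop)
  obtain ⟨u, hu, hu0⟩ := intermediate_value_Icc (by linarith : 1 - z ≤ 1)
    (hgc.mono (Icc_subset_Icc (by linarith) le_rfl))
    (show (0 : ℝ) ∈ Icc _ _ from ⟨by linarith, by simp only [sub_self]; linarith⟩)
  simp only at hu0
  have hu1 : u < 1 := lt_of_le_of_ne hu.2 (by rintro rfl; rw [sub_self] at hu0; linarith)
  have hup : 0 < u := by linarith [hu.1]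
  -- Were `h (1 - u) ≤ l`, then `h ≤ l` on `[1 - u, z]` too, and the strict deficit at `1 - z` would
  -- persist up to `u`.
  have hlu : l < h (1 - u) := by
    by_contra! hle
    have e1 := hadd (1 - z) u (by linarith) hu.1 hu.2
    have e2 := profile_integral_le hc ha (a := 1 - u) (b := 1 - (1 - z)) (by linarith)
      (by linarith [hu.1]) (by linarith)
    have e3 : (1 - (1 - z) - (1 - u)) * h (1 - u) ≤ (1 - (1 - z) - (1 - u)) * l := by
      gcongr
      linarith [hu.1]
    nlinarith
  refine ⟨u, ⟨hup, hu1⟩, by linarith, hlu, fun η hη => ?_⟩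
  -- points on the left at which the profile still exceeds `l`
  have hcat : ContinuousAt (fun v => h (1 - v)) u := by
    have h1 : ContinuousAt h (1 - u) :=
      hc.continuousAt (Icc_mem_nhds (by linarith) (by linarith))
    exact ContinuousAt.comp (f := fun v : ℝ => 1 - v) h1
      (by fun_prop : Continuous fun v : ℝ => 1 - v).continuousAt
  obtain ⟨r, hr, hball⟩ := Metric.eventually_nhds_iff.1
    (continuousAt_const.eventually_lt hcat hlu)
  set m := min (min (r / 2) (η / 2)) (min (u / 2) ((1 - u) / 2)) with hm
  have hm0 : 0 < m := lt_min (lt_min (by linarith) (by linarith)) (lt_min (by linarith)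
    (by linarith))
  have hmr : m ≤ r / 2 := (min_le_left _ _).trans (min_le_left _ _)
  have hmη : m ≤ η / 2 := (min_le_left _ _).trans (min_le_right _ _)
  have hmu : m ≤ u / 2 := (min_le_right _ _).trans (min_le_left _ _)
  have hmu' : m ≤ (1 - u) / 2 := (min_le_right _ _).trans (min_le_right _ _)
  have hlm : l < h (1 - (u - m)) := hball (by
    rw [Real.dist_eq, abs_lt]; constructor <;> linarith)
  -- To the left of `u` the bound `hlm` is used; to the right `h ≥ h (1 - u) > l` by monotonicity.
  refine ⟨u - m, u + m, by linarith, by linarith, by linarith, by linarith, by linarith, ?_, ?_⟩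
  · have e1 := hadd (u - m) u (by linarith) (by linarith) hu.2
    have e2 := le_profile_integral hc ha (a := 1 - u) (b := 1 - (u - m)) (by linarith)
      (by linarith) (by linarith)
    nlinarith
  · have e1 := hadd u (u + m) hup.le (by linarith) (by linarith)
    have e2 := le_profile_integral hc ha (a := 1 - (u + m)) (b := 1 - u) (by linarith)
      (by linarith) (by linarith)
    nlinarith

end Profile

/-! ### Position of the segments relative to the arc, to first order in `α`. -/

section Estimates

variable {ρ α : ℝ} {h : ℝ → ℝ}

theorem IsTable.abs_tangentAngle_le (H : IsTable ρ α h) {s : ℝ}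
    (hs : s ∈ Icc (-smoothLength ρ α h) (smoothLength ρ α h)) : |tangentAngle ρ α h s| ≤ α := by
  have h1 := H.monotone_tangentAngle hs.1
  have h2 := H.monotone_tangentAngle hs.2
  rw [H.tangentAngle_neg, H.tangentAngle_smoothLength] at h1
  rw [H.tangentAngle_smoothLength] at h2
  exact abs_le.2 ⟨h1, h2⟩

theorem IsTable.abs_boundary_fst_sub_le (H : IsTable ρ α h) {s s' : ℝ}
    (hs : s ∈ Icc (-smoothLength ρ α h) (smoothLength ρ α h))
    (hs' : s' ∈ Icc (-smoothLength ρ α h) (smoothLength ρ α h)) :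
    |(boundary ρ α h s').1 - (boundary ρ α h s).1 - (s' - s)| ≤ α ^ 2 / 2 * |s' - s| := by
  have key := (convex_Icc (-smoothLength ρ α h)
    (smoothLength ρ α h)).norm_image_sub_le_of_norm_hasDerivWithin_le
    (f := fun s => (boundary ρ α h s).1 - s) (C := α ^ 2 / 2)
    (fun x _ => ((H.hasStrictDerivAt_boundary_fst x).hasDerivAt.sub
      (hasDerivAt_id x)).hasDerivWithinAt)
    (fun x hx => by
      rw [Real.norm_eq_abs]
      refine (abs_cos_sub_one_le _).trans ?_
      have := H.abs_tangentAngle_le hx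
      rw [← sq_abs]
      gcongr) hs hs'
  rw [Real.norm_eq_abs, Real.norm_eq_abs] at key
  convert key using 2
  ring

theorem IsTable.abs_boundary_snd_sub_le (H : IsTable ρ α h) {s s' : ℝ}
    (hs : s ∈ Icc (-smoothLength ρ α h) (smoothLength ρ α h))
    (hs' : s' ∈ Icc (-smoothLength ρ α h) (smoothLength ρ α h)) :
    |(boundary ρ α h s').2 - (boundary ρ α h s).2| ≤ α * |s' - s| :=
  (convex_Icc (-smoothLength ρ α h)
    (smoothLength ρ α h)).norm_image_sub_le_of_norm_hasDerivWithin_le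
    (fun x _ => (H.hasStrictDerivAt_boundary_snd x).hasDerivAt.hasDerivWithinAt)
    (fun _ hx => abs_sin_le_abs.trans (H.abs_tangentAngle_le hx)) hs hs'

/-- Horizontal coordinate, relative to the centre of the circular arc and in units of `ρ`, of a
point of the smoothened segments near the joint. -/
noncomputable def relFst (ρ α : ℝ) (h : ℝ → ℝ) (u : ℝ) : ℝ :=
  ((boundary ρ α h (smoothLength ρ α h * u)).1 - (arcCenter ρ α h).1) / ρ

/-- Depth below the centre of the circular arc, in units of `ρ`, of a point of the smoothened
segments near the joint. -/
noncomputable def relDepth (ρ α : ℝ) (h : ℝ → ℝ) (u : ℝ) : ℝ :=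
  ((arcCenter ρ α h).2 - (boundary ρ α h (smoothLength ρ α h * u)).2) / ρ

theorem IsTable.continuous_relFst (H : IsTable ρ α h) : Continuous (relFst ρ α h) :=
  ((H.continuous_boundary_fst.comp (continuous_const.mul continuous_id)).sub
    continuous_const).div_const ρ

theorem IsTable.continuous_relDepth (H : IsTable ρ α h) : Continuous (relDepth ρ α h) :=
  (continuous_const.sub
    (H.continuous_boundary_snd.comp (continuous_const.mul continuous_id))).div_const ρ

theorem IsTable.smoothLength_mul_mem (H : IsTable ρ α h) {u : ℝ} (hu : u ∈ Icc (-1 : ℝ) 1) :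
    smoothLength ρ α h * u ∈ Icc (-smoothLength ρ α h) (smoothLength ρ α h) := by
  have := H.smoothLength_pos
  constructor <;> nlinarith [hu.1, hu.2]

/-- The bound `∫ h > 1/2` gives `s_α ≤ 2 α ρ`, and the two points are at most `2 s_α` apart. -/
theorem IsTable.abs_smoothLength_sub_le (H : IsTable ρ α h)
    (hI : 1 / 2 < ∫ ξ in (0 : ℝ)..1, h ξ) {u : ℝ} (hu : u ∈ Icc (-1 : ℝ) 1) :
    |smoothLength ρ α h * u - smoothLength ρ α h| ≤ 4 * α * ρ := by
  have h1 : smoothLength ρ α h ≤ 2 * α * ρ := by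
    unfold smoothLength
    rw [div_le_iff₀ H.int_pos]
    nlinarith [mul_pos H.rho_pos H.alpha_pos]
  have h2 := H.smoothLength_pos
  rw [abs_le]
  constructor <;> nlinarith [hu.1, hu.2]

theorem IsTable.smoothLength_mem (H : IsTable ρ α h) :
    smoothLength ρ α h ∈ Icc (-smoothLength ρ α h) (smoothLength ρ α h) :=
  ⟨by linarith [H.smoothLength_pos], le_rfl⟩

theorem IsTable.abs_relDepth_sub_one_le (H : IsTable ρ α h)
    (hI : 1 / 2 < ∫ ξ in (0 : ℝ)..1, h ξ) {u : ℝ} (hu : u ∈ Icc (-1 : ℝ) 1) :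
    |relDepth ρ α h u - 1| ≤ 5 * α ^ 2 := by
  have hρ := H.rho_pos
  have h1 := H.abs_boundary_snd_sub_le H.smoothLength_mem (H.smoothLength_mul_mem hu)
  have h2 := H.abs_smoothLength_sub_le hI hu
  have h3 : α * |smoothLength ρ α h * u - smoothLength ρ α h| ≤ 4 * α ^ 2 * ρ := by
    have := mul_le_mul_of_nonneg_left h2 H.alpha_pos.le
    linarith
  have e : relDepth ρ α h u - 1 = (cos α - 1) -
      ((boundary ρ α h (smoothLength ρ α h * u)).2 -
        (boundary ρ α h (smoothLength ρ α h)).2) / ρ := by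
    unfold relDepth arcCenter
    field_simp
    ring
  have h4 : |((boundary ρ α h (smoothLength ρ α h * u)).2 -
        (boundary ρ α h (smoothLength ρ α h)).2) / ρ| ≤ 4 * α ^ 2 := by
    rw [abs_div, abs_of_pos hρ, div_le_iff₀ hρ]
    exact h1.trans h3
  rw [e]
  refine (abs_sub _ _).trans ?_
  nlinarith [abs_cos_sub_one_le α, sq_nonneg α]

theorem IsTable.abs_relFst_sub_le (H : IsTable ρ α h)
    (hI : 1 / 2 < ∫ ξ in (0 : ℝ)..1, h ξ) (hα : α ≤ 1) {u : ℝ} (hu : u ∈ Icc (-1 : ℝ) 1) :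
    |relFst ρ α h u - α * ((u - 1) / (∫ ξ in (0 : ℝ)..1, h ξ) + 1)| ≤ 3 * α ^ 2 := by
  have hρ := H.rho_pos
  have hI0 := H.int_pos.ne'
  have hα0 := H.alpha_pos
  have h1 := H.abs_boundary_fst_sub_le H.smoothLength_mem (H.smoothLength_mul_mem hu)
  have h2 := H.abs_smoothLength_sub_le hI hu
  have h3 : α ^ 2 / 2 * |smoothLength ρ α h * u - smoothLength ρ α h| ≤ 2 * α ^ 2 * ρ := by
    have h4 : α ^ 2 / 2 * |smoothLength ρ α h * u - smoothLength ρ α h| ≤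
      α ^ 2 / 2 * (4 * α * ρ) := by gcongr
    have h5 : α ^ 2 * ρ * α ≤ α ^ 2 * ρ * 1 := by gcongr
    linarith
  have e : relFst ρ α h u - α * ((u - 1) / (∫ ξ in (0 : ℝ)..1, h ξ) + 1) = (sin α - α) +
      ((boundary ρ α h (smoothLength ρ α h * u)).1 -
        (boundary ρ α h (smoothLength ρ α h)).1 -
        (smoothLength ρ α h * u - smoothLength ρ α h)) / ρ := by
    unfold relFst arcCenter
    simp only []
    have : (smoothLength ρ α h * u - smoothLength ρ α h) / ρ =
        α * ((u - 1) / (∫ ξ in (0 : ℝ)..1, h ξ)) := by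
      unfold smoothLength
      field_simp
    rw [sub_div _ (smoothLength ρ α h * u - smoothLength ρ α h) ρ, this]
    field_simp
    ring
  have h4 : |((boundary ρ α h (smoothLength ρ α h * u)).1 -
        (boundary ρ α h (smoothLength ρ α h)).1 -
        (smoothLength ρ α h * u - smoothLength ρ α h)) / ρ| ≤ 2 * α ^ 2 := by
    rw [abs_div, abs_of_pos hρ, div_le_iff₀ hρ]
    exact h1.trans h3
  have h5 := abs_sin_sub_self_le (x := α) (by rwa [abs_of_pos hα0])
  rw [e]
  refine (abs_add_le _ _).trans ?_
  linarith

/-- Length, in units of `ρ`, of a flight from the smoothened segments to the circular arc. -/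
noncomputable def entryLength (k δ₀ A b x : ℝ) : ℝ :=
  -b * sin (k * (δ₀ + x)) + A * cos (k * (δ₀ + x)) + sin (δ₀ + x)

/-- The unperturbed chord has length `2 sin δ₀`. The constant is `6k + 6` from the two angles, `8`
from `b` and `5` from `A`. -/
theorem abs_entryLength_sub_le {k δ₀ A b x α β : ℝ} (hk : 1 ≤ k)
    (hcs : cos (k * δ₀) = sin δ₀) (hα : 0 ≤ α) (hα1 : α ≤ 1) (hβ : |β| ≤ 5)
    (hA : |A - 1| ≤ 5 * α ^ 2) (hb : |b - α * β| ≤ 3 * α ^ 2) (hx : |x| ≤ 6 * α) :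
    |entryLength k δ₀ A b x - 2 * sin δ₀| ≤ (6 * k + 19) * α := by
  have h1 : |sin (δ₀ + x) - sin δ₀| ≤ 6 * α := by
    have := abs_sin_sub_sin_le (δ₀ + x) δ₀
    rw [add_sub_cancel_left] at this
    exact this.trans hx
  have h2 : |cos (k * (δ₀ + x)) - sin δ₀| ≤ k * (6 * α) := by
    have h3 := abs_cos_sub_cos_le (k * (δ₀ + x)) (k * δ₀)
    rw [hcs, show k * (δ₀ + x) - k * δ₀ = k * x by ring, abs_mul,
      abs_of_pos (by linarith : 0 < k)] at h3
    exact h3.trans (by gcongr)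
  have hα2 : α ^ 2 ≤ α := by nlinarith
  have hb8 : |b| ≤ 8 * α := by
    have h1 : |b| ≤ |b - α * β| + |α * β| := by simpa using abs_add_le (b - α * β) (α * β)
    rw [abs_mul, abs_of_nonneg hα] at h1
    nlinarith
  have h3 : |b * sin (k * (δ₀ + x))| ≤ 8 * α := by
    rw [abs_mul]
    exact (mul_le_of_le_one_right (abs_nonneg _) (abs_sin_le_one _)).trans hb8
  have h4 : |(A - 1) * cos (k * (δ₀ + x))| ≤ 5 * α := by
    rw [abs_mul]
    exact (mul_le_of_le_one_right (abs_nonneg _) (abs_cos_le_one _)).trans (by linarith)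
  have e : entryLength k δ₀ A b x - 2 * sin δ₀ = -(b * sin (k * (δ₀ + x))) +
      (A - 1) * cos (k * (δ₀ + x)) + (cos (k * (δ₀ + x)) - sin δ₀) +
      (sin (δ₀ + x) - sin δ₀) := by
    unfold entryLength; ring
  rw [e]
  rw [abs_le] at h1 h2 h3 h4 ⊢
  constructor <;> linarith [h1.1, h1.2, h2.1, h2.2, h3.1, h3.2, h4.1, h4.2]

/-- `IsTable.half_chain` in normalized coordinates. -/
theorem IsTable.half_chain_of_defect (H : IsTable ρ α h) (n : ℕ) {u φ δ₀ x : ℝ}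
    (hu : u ∈ Icc (-1 : ℝ) 1) (hδ₀ : 4 * (n + 1) * δ₀ = π) (hx : |x| ≤ 6 * α)
    (hα : (6 * (2 * n + 1) + 19) * α < δ₀)
    (hφ : φ = tangentAngle ρ α h (smoothLength ρ α h * u) + (2 * n + 1) * (δ₀ + x))
    (h0 : chordDefect (2 * n + 1) δ₀ (relDepth ρ α h u) (relFst ρ α h u) x = 0)
    (hpos : 0 < entryLength (2 * n + 1) δ₀ (relDepth ρ α h u) (relFst ρ α h u) x) :
    FlightChain ρ α h (2 * n + 2) (smoothLength ρ α h * u, φ)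
      (componentLength ρ α h - smoothLength ρ α h * u, φ)
      (chainDeriv n ρ (curvature ρ α h (smoothLength ρ α h * u)) (cos φ) (sin (δ₀ + x))
        (ρ * entryLength (2 * n + 1) δ₀ (relDepth ρ α h u) (relFst ρ α h u) x)) := by
  have hρ := H.rho_pos
  have hα0 := H.alpha_pos
  have hmem := H.smoothLength_mul_mem hu
  have hθ := abs_le.1 (H.abs_tangentAngle_le hmem)
  have hx1 := (abs_le.1 hx).1
  have hx2 := (abs_le.1 hx).2
  have hn : (0 : ℝ) ≤ n := Nat.cast_nonneg n
  have hnα : 0 ≤ n * α := by positivity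
  have hnx1 : n * x ≤ n * (6 * α) := by gcongr
  have hnx2 : n * (-(6 * α)) ≤ n * x := by gcongr
  have hδ₀' : 0 < δ₀ := by nlinarith
  have hnδ : 0 ≤ n * δ₀ := by positivity
  have e1 : ((arcCenter ρ α h).2 - (boundary ρ α h (smoothLength ρ α h * u)).2) =
      ρ * relDepth ρ α h u := by unfold relDepth; field_simp
  have e2 : ((arcCenter ρ α h).1 - (boundary ρ α h (smoothLength ρ α h * u)).1) =
      -(ρ * relFst ρ α h u) := by unfold relFst; field_simp; ring
  have e3 : ((arcCenter ρ α h).1 - (boundary ρ α h (smoothLength ρ α h * u)).1) *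
      sin ((2 * n + 1) * (δ₀ + x)) + ((arcCenter ρ α h).2 -
      (boundary ρ α h (smoothLength ρ α h * u)).2) * cos ((2 * n + 1) * (δ₀ + x)) +
      ρ * sin (δ₀ + x) =
      ρ * entryLength (2 * n + 1) δ₀ (relDepth ρ α h u) (relFst ρ α h u) x := by
    rw [e1, e2]; unfold entryLength; ring
  have key := H.half_chain n (s := smoothLength ρ α h * u) (φ := φ) (δ := δ₀ + x) hmem
    (by rw [hφ, abs_lt]; constructor <;> nlinarith) (by nlinarith) (by nlinarith) (by nlinarith)
    hφ (by rw [e1, e2]; unfold chordDefect at h0; linear_combination (-ρ) * h0)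
    (by rw [e3]; exact mul_pos hρ hpos)
  rw [e3] at key
  exact key

end Estimates

end SmoothStadium

/-! ### Assembling the orbit. -/

set_option maxHeartbeats 800000 in
theorem mainTheorem5
    (h : ℝ → ℝ)
    (h_cont : ContinuousOn h (Set.Icc 0 1))
    (h_anti : AntitoneOn h (Set.Icc 0 1))
    (h_zero : h 0 = 1)
    (h_one : h 1 = 0)
    (h_int : 1 / 2 < ∫ ξ in (0 : ℝ)..1, h ξ)
    (h_lt : ∀ ζ : ℝ, 0 < ζ → ζ ≤ 1 → h ζ < h 0)
    (n : ℕ)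
    (h_nondeg : SmoothStadium.NonDegenerate h n) :
    ∃ α₀ : ℝ, 0 < α₀ ∧ ∀ ρ α : ℝ, 0 < ρ → 0 < α → α < α₀ →
      ∃ x : ℝ × ℝ,
        SmoothStadium.IsPeriodicState ρ α h (4 * (n + 1)) x ∧
        SmoothStadium.IsLinearlyStable ρ α h (4 * (n + 1)) x := by
  open SmoothStadium in
  obtain ⟨hl, hnd⟩ := h_nondeg
  have hn : (0 : ℝ) ≤ n := Nat.cast_nonneg n
  set l : ℝ := (2 * (n : ℝ) + 1) / (2 * n + 2) with hl_def
  have hl0 : 0 < l := by positivity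
  have hl1 : l < 1 := by rw [hl_def, div_lt_one (by positivity)]; linarith
  set I := ∫ ξ in (0 : ℝ)..1, h ξ with hI
  have hI0 : 0 < I := by linarith
  obtain ⟨u₀, hu₀, hroot, hlu, hnear⟩ :=
    exists_profile_root h_cont h_anti h_one h_zero hl0 hl1 hl
  have hκ1 : h (1 - u₀) < 1 := by
    rw [← h_zero]; exact h_lt _ (by linarith [hu₀.2]) (by linarith [hu₀.1])
  have hκ2 := hnd (1 - u₀) ⟨by linarith [hu₀.2], by linarith [hu₀.1]⟩
    (by rw [sub_sub_cancel]; exact hroot.symm)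
  -- the unperturbed angle
  set δ₀ : ℝ := Real.pi / (4 * (n + 1)) with hδ₀_def
  have hδ₀ : 4 * (n + 1) * δ₀ = Real.pi := by rw [hδ₀_def]; field_simp
  have hδ₀_pos : 0 < δ₀ := by positivity
  have hδ₀_le : δ₀ ≤ Real.pi / 4 := by
    linarith [mul_nonneg hn hδ₀_pos.le]
  have hs : 0 < Real.sin δ₀ := Real.sin_pos_of_pos_of_lt_pi hδ₀_pos (by linarith [Real.pi_pos])
  have hkδ : (2 * n + 1) * δ₀ = Real.pi / 2 - δ₀ := by linarith
  have hcs : Real.cos ((2 * n + 1) * δ₀) = Real.sin δ₀ := by rw [hkδ, Real.cos_pi_div_two_sub]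
  have hsc : Real.sin ((2 * n + 1) * δ₀) = Real.cos δ₀ := by rw [hkδ, Real.sin_pi_div_two_sub]
  have hk : (1 : ℝ) ≤ 2 * n + 1 := by linarith
  have hk0 : (0 : ℝ) < 2 * n + 1 := by linarith
  obtain ⟨ε, hε, htrace⟩ := exists_abs_cycleTrace_lt n hs.ne' hlu hκ1 hκ2
  -- a neighbourhood of the solution of the linearized equation
  have hcat : ContinuousAt (fun v => h (1 - v)) u₀ :=
    ContinuousAt.comp (f := fun v : ℝ => 1 - v)
      (h_cont.continuousAt (Icc_mem_nhds (by linarith [hu₀.2]) (by linarith [hu₀.1])))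
      (by fun_prop : Continuous fun v : ℝ => 1 - v).continuousAt
  obtain ⟨η, hη, hclose⟩ := Metric.continuousAt_iff.1 hcat ε hε
  obtain ⟨u₁, u₂, hu₁, hu₁₂, hu₂, hu₁η, hu₂η, hT₁, hT₂⟩ := hnear η hη
  have hlk : (2 * (n : ℝ) + 1) / (2 * n + 1 + 1) = l := by rw [hl_def]; congr 1; ring
  obtain ⟨α₁, hα₁, hsol⟩ := exists_symmetric_solution hk hs hcs hsc h_int hu₁ hu₁₂ hu₂
    (T := fun u => (∫ ξ in (1 - u)..1, h ξ) / I)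
    ((continuousOn_profile_integral h_cont).div_const I)
    (by rw [hlk, ← mul_div_assoc]; gcongr) (by rw [hlk, ← mul_div_assoc]; gcongr)
  set K : ℝ := 6 * (2 * n + 1) + 19 with hK_def
  have hK : 0 < K := by positivity
  -- All deviations from the regular polygon except that of the curvature are below `K α`. The bound
  -- `δ₀ / K` keeps the reflections on the arcs and `|φ| < π/2`, `ε / K` controls the trace, and
  -- `sin δ₀ / K` keeps flight lengths and cosines positive.
  refine ⟨min α₁ (min 1 (min (δ₀ / K) (min (ε / K) (Real.sin δ₀ / K)))), by positivity, ?_⟩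
  intro ρ α hρ hα hαlt
  simp only [lt_min_iff] at hαlt
  obtain ⟨hα2, hα3, hα4, hα5, hα6⟩ := hαlt
  rw [lt_div_iff₀ hK, mul_comm] at hα4 hα5 hα6
  have H : IsTable ρ α h := ⟨h_cont, h_anti, h_zero, h_one, hI0, hρ, hα, by
    linarith [Real.pi_gt_three]⟩
  obtain ⟨u, hu, x, y, hx, hy, hx0, hy0, hxy⟩ := hsol α hα hα2 _ _ H.continuous_relDepth
    H.continuous_relFst (fun u hu => H.abs_relDepth_sub_one_le h_int hu)
    (fun u hu => H.abs_relFst_sub_le h_int hα3.le hu)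
  have hu01 : u ∈ Set.Icc (0 : ℝ) 1 := ⟨hu₁.trans hu.1, hu.2.trans hu₂⟩
  have hum : u ∈ Set.Icc (-1 : ℝ) 1 := ⟨by linarith [hu01.1], hu01.2⟩
  have hum' : -u ∈ Set.Icc (-1 : ℝ) 1 := ⟨by linarith [hu01.2], by linarith [hu01.1]⟩
  have hβ : ∀ v ∈ Set.Icc (-1 : ℝ) 1, |(v - 1) / I + 1| ≤ 5 := by
    intro v hv
    have h1 : (1 - v) / I ≤ 4 := by
      rw [div_le_iff₀ hI0]; linarith [hv.1]
    have h2 : 0 ≤ (1 - v) / I := div_nonneg (by linarith [hv.2]) hI0.le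
    have h3 : (v - 1) / I = -((1 - v) / I) := by ring
    rw [h3, abs_le]
    constructor <;> linarith
  have hτ₁ := abs_entryLength_sub_le (δ₀ := δ₀) hk hcs hα.le hα3.le (hβ u hum)
    (H.abs_relDepth_sub_one_le h_int hum) (H.abs_relFst_sub_le h_int hα3.le hum) hx
  have hτ₂ := abs_entryLength_sub_le (δ₀ := δ₀) hk hcs hα.le hα3.le (hβ (-u) hum')
    (H.abs_relDepth_sub_one_le h_int hum') (H.abs_relFst_sub_le h_int hα3.le hum') hy
  rw [← hK_def] at hτ₁ hτ₂
  set s := smoothLength ρ α h * u with hs_def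
  have hθ : tangentAngle ρ α h s = α * ((∫ ξ in (1 - u)..1, h ξ) / I) :=
    H.tangentAngle_smooth hu01.1 hu01.2
  set φ : ℝ := tangentAngle ρ α h s + (2 * n + 1) * (δ₀ + x) with hφ_def
  have hneg : smoothLength ρ α h * -u = -s := by rw [hs_def]; ring
  -- The equation for `y - x` says that both half chains have the same angle `φ` at their ends, so
  -- that they fit together.
  have hφ' : φ = tangentAngle ρ α h (smoothLength ρ α h * -u) + (2 * n + 1) * (δ₀ + y) := by
    rw [hneg, H.tangentAngle_neg, hφ_def]
    linear_combination 2 * hθ - hxy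
  have c1 := H.half_chain_of_defect n hum hδ₀ hx hα4 hφ_def hx0
    (by linarith [(abs_le.1 hτ₁).1])
  -- The first half ends at `componentLength - s`, which is `-s` shifted by one component. The
  -- second half is therefore the chain from `-s`, shifted likewise.
  have c2 := (H.half_chain_of_defect n hum' hδ₀ hy hα4 hφ' hy0
    (by linarith [(abs_le.1 hτ₂).1])).shift H
  rw [hneg, H.curvature_neg] at c2
  rw [← hs_def] at c1
  simp only [neg_add_eq_sub] at c2
  have c := c1.trans c2
  have hend : componentLength ρ α h - -s + componentLength ρ α h = s + perimeter ρ α h := by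
    unfold perimeter; ring
  rw [hend, show 2 * n + 2 + (2 * n + 2) = 4 * (n + 1) by ring] at c
  have hκ : curvature ρ α h s = h (1 - u) / ρ := by
    have h1 := H.smoothLength_pos
    rw [H.curvature_of_le_smoothLength (mul_nonneg h1.le hu01.1)
      (mul_le_of_le_one_right h1.le hu01.2), mul_div_cancel_left₀ _ h1.ne']
  rw [hκ] at c
  -- closeness to the unperturbed orbit
  have hnα : 0 ≤ n * α := by positivity
  have h6K : 6 * α < K * α := by rw [hK_def]; linarith
  have hθα := H.abs_tangentAngle_le (H.smoothLength_mul_mem hum)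
  rw [← hs_def] at hθα
  have hφ_close : |φ - (2 * n + 1) * δ₀| ≤ (6 * (2 * n + 1) + 1) * α := by
    have e : φ - (2 * n + 1) * δ₀ = tangentAngle ρ α h s + (2 * n + 1) * x := by
      rw [hφ_def]; ring
    rw [e]
    refine (abs_add_le _ _).trans ?_
    rw [abs_mul, abs_of_pos hk0]
    have : (2 * n + 1) * |x| ≤ (2 * n + 1) * (6 * α) := by gcongr
    linarith
  have hcK : (6 * (2 * n + 1) + 1) * α < K * α := by rw [hK_def]; linarith
  have hφ_abs : |φ| < Real.pi / 2 := by
    rw [hkδ] at hφ_close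
    have := abs_le.1 hφ_close
    rw [abs_lt]
    constructor <;> linarith [this.1, this.2]
  have hc_close : |Real.cos φ - Real.sin δ₀| ≤ (6 * (2 * n + 1) + 1) * α := by
    rw [← hcs]; exact (Real.abs_cos_sub_cos_le _ _).trans hφ_close
  have hd_close : ∀ z, |z| ≤ 6 * α → |Real.sin (δ₀ + z) - Real.sin δ₀| ≤ 6 * α := by
    intro z hz
    have := Real.abs_sin_sub_sin_le (δ₀ + z) δ₀
    rw [add_sub_cancel_left] at this
    exact this.trans hz
  have hd1 := hd_close x hx
  have hd2 := hd_close y hy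
  have hκ_close : |h (1 - u) - h (1 - u₀)| < ε := hclose (by
    rw [Real.dist_eq, abs_lt]; constructor <;> linarith [hu.1, hu.2])
  refine ⟨(s, φ), c.isPeriodicState H (by omega) hφ_abs, _, c.hasFDerivAt H, ?_, ?_⟩
  · refine det_chainDeriv_comp n hρ.ne' _ _ _ (cos_pos_of_abs_lt hφ_abs).ne' ?_ ?_
    · exact (by linarith [(abs_le.1 hd1).1] : 0 < Real.sin (δ₀ + x)).ne'
    · exact (by linarith [(abs_le.1 hd2).1] : 0 < Real.sin (δ₀ + y)).ne'
  · rw [trace_chainDeriv_comp n hρ.ne']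
    exact htrace _ _ _ _ _ _ hκ_close (by linarith) (by linarith) (by linarith) (by linarith)
      (by linarith)
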